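/- Throughout, designs are finite. Let $V$ be a finite set of points, $\Pi$ a partition of $V$ into nonempty groups, and $\mathcal B$ a finite multiset of subsets of $V$ (blocks). The *frequency* of a pair $\{x,y\}$ of distinct points is the number of blocks, counted with multiplicity, that contain both $x$ and $y$. The triple $(V,\Pi,\mathcal B)$ has *type* $g^u$ if $\Pi$ consists of exactly $u$ groups, each of size $g$. - A *$\{3,4,5\}$-GDD* is such a triple in which every block has size $3$, $4$ or $5$, every pair of distinct points in the same group has frequency $0$, and every pair of points in different groups has frequency $1$. - An *SBGDD* (Sarvate–Beam group divisible design, with starting frequency $0$) is such a triple in which every block has size $3$, every pair of distinct points in the same group has frequency $0$, and, if $N$ is the number of pairs of points in different groups, the frequencies of these $N$ pairs are $0,1,\dots,N-1$ in some order (each attained exactly once). - An *SBTS$(5)$* on a $5$-set $W$ is a finite multiset of $3$-subsets of $W$ such that the frequencies of the ten pairs of points of $W$ are $0,1,\dots,9$ in some order. - An SBGDD has a *sub-SBTS$(5)$* if there is a set $W$ of five points, no two in the same group, such that the blocks contained in $W$ form an SBTS$(5)$ on $W$, and every other block contains at most one point of $W$. Let $g,m\ge 1$ and $u$ be integers, and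 suppose there exists a $\{3,4,5\}$-GDD of type $g^u$. Suppose further that, for each block size $k$ actually occurring in this GDD, there exists an SBGDD of type $m^k$, which moreover has a sub-SBTS$(5)$ in the event that $k=5$ and $3\nmid m$. Then there exists an SBGDD of type $(mg)^u$. -/

import Mathlib

/-- The frequency of a set `e` of points (here: a pair) in a multiset `B` of blocks: the number of
blocks, counted with multiplicity, that contain `e`. -/
def blockFreq {V : Type*} [DecidableEq V] (B : Multiset (Finset V)) (e : Finset V) : ℕ :=
  B.countP fun b => e ⊆ b

/-- The 2-element subsets of the point set that are not contained in a single group. -/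
def crossPairs {V : Type*} [Fintype V] [DecidableEq V]
    (P : Finpartition (Finset.univ : Finset V)) : Finset (Finset V) :=
  (Finset.powersetCard 2 Finset.univ).filter fun e => ∀ G ∈ P.parts, ¬ e ⊆ G

/-- No pair of distinct points of the same group is contained in a block. -/
def SameGroupFreqZero {V : Type*} [Fintype V] [DecidableEq V]
    (P : Finpartition (Finset.univ : Finset V)) (B : Multiset (Finset V)) : Prop :=
  ∀ G ∈ P.parts, ∀ e ∈ Finset.powersetCard 2 G, blockFreq B e = 0

/-- The group partition has type `g ^ u`: there are exactly `u` groups, all of size `g`. -/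
def HasUniformType {V : Type*} [Fintype V] [DecidableEq V]
    (P : Finpartition (Finset.univ : Finset V)) (g u : ℕ) : Prop :=
  P.parts.card = u ∧ ∀ G ∈ P.parts, G.card = g

/-- `(V, P, B)` is a `K`-GDD, that is, a group divisible design (of index one) with point set `V`,
groups the parts of `P`, and blocks `B`, all of whose block sizes belong to `K`. -/
structure IsGDD {V : Type*} [Fintype V] [DecidableEq V] (K : Set ℕ)
    (P : Finpartition (Finset.univ : Finset V)) (B : Multiset (Finset V)) : Prop where
  block_card : ∀ b ∈ B, b.card ∈ K
  same_group : SameGroupFreqZero P B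
  cross : ∀ e ∈ crossPairs P, blockFreq B e = 1

/-- `(V, P, B)` is a Sarvate-Beam group divisible design with blocks of size three and starting
frequency `μ`: pairs inside a group have frequency zero, and the frequencies of the pairs across
different groups are `μ, μ + 1, μ + 2, …`, each attained by exactly one pair. -/
structure IsSBGDD {V : Type*} [Fintype V] [DecidableEq V] (μ : ℕ)
    (P : Finpartition (Finset.univ : Finset V)) (B : Multiset (Finset V)) : Prop where
  block_card : ∀ b ∈ B, b.card = 3
  same_group : SameGroupFreqZero P B
  cross : Set.BijOn (blockFreq B) (crossPairs P : Set (Finset V))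
    (Set.Ico μ (μ + (crossPairs P).card))

/-- `(W, A)` is a Sarvate-Beam triple system `SBTS_μ(|W|)`: the blocks in `A` are 3-element subsets
of `W`, and the frequencies of the pairs of points of `W` are `μ, μ + 1, …, μ + (|W| choose 2) - 1`,
each attained by exactly one pair. -/
structure IsSBTS {V : Type*} [DecidableEq V] (μ : ℕ) (W : Finset V)
    (A : Multiset (Finset V)) : Prop where
  block_subset : ∀ b ∈ A, b ⊆ W
  block_card : ∀ b ∈ A, b.card = 3
  freq : Set.BijOn (blockFreq A) (Finset.powersetCard 2 W : Set (Finset V))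
    (Set.Ico μ (μ + W.card.choose 2))

/-- The design `(V, P, B)` has a sub-`SBTS(v)` (starting frequency zero): there is a set `W` of `v`
points, no two in the same group, such that the blocks inside `W` form an `SBTS_0(v)` on `W`, and
no other block contains a pair of points of `W`. Hence removing the blocks inside `W` leaves an
incomplete design in which `W` is a hole. -/
def HasSubSBTS {V : Type*} [Fintype V] [DecidableEq V] (v : ℕ)
    (P : Finpartition (Finset.univ : Finset V)) (B : Multiset (Finset V)) : Prop :=
  ∃ W : Finset V, W.card = v ∧ (∀ G ∈ P.parts, (W ∩ G).card ≤ 1) ∧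
    IsSBTS 0 W (B.filter fun b => b ⊆ W) ∧
    ∀ b ∈ B, ¬ b ⊆ W → (b ∩ W).card ≤ 1

open Finset

/-! Give every point weight `m` and replace each block of size `k` by a copy of the type `m^k`
ingredient, shifted so that the frequencies of the copies tile an initial interval. Since the GDD
has index one, distinct blocks govern disjoint sets of pairs, so only the shifts need care.

An ingredient is raised by a constant `μ` by adding triples that cover every cross pair exactly `μ`
times. A Latin square on each triple of groups covers every cross pair `k - 2` times, so `μ` may be
any multiple of `k - 2` (`isTripleSum_cross`). Blocks of size 4 come first: each uses `6 * m ^ 2`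
frequencies, so starting points stay even, and the end is a multiple of 3. Blocks of size 3 come
last and accept any start. Blocks of size 5, in between, need starts divisible by 3 and use `10 * m
^ 2` frequencies each, which is harmless if `3 ∣ m`.

If `3 ∤ m`, blocks of size 5 are taken three at a time (`exists_realizes_three`). Removing the
sub-SBTS(5) leaves a design with a hole and frequencies from 10 to `10 * m ^ 2 - 1`. The pairs
outside the hole can be raised by any sufficiently large constant (`isTripleSum_holey`). The three
holes then share 30 leftover frequencies, distributed so that each hole's frequencies sum to a
multiple of 3, as triples require. At most one block of size 5 remains, and it starts at a multiple
of 3: counting pairs, the number of such blocks is congruent mod 3 to `u.choose 2 * g ^ 2`, which is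
never 2 (`choose_two_mul_sq_mod_three`). -/

theorem blockFreq_map_pair_eq_zero {X Y : Type*} [DecidableEq Y] (f : X ↪ Y) (D : Multiset (Finset X)) (x y : Y)
    (h : ¬ ((∃ a, f a = x) ∧ ∃ b, f b = y)) :
    blockFreq (D.map (Finset.map f)) {x, y} = 0 := by
  refine Multiset.countP_eq_zero.2 ?_
  intro b hb hs
  obtain ⟨c, -, rfl⟩ := Multiset.mem_map.1 hb
  simp only [Finset.insert_subset_iff, Finset.singleton_subset_iff, Finset.mem_map] at hs
  obtain ⟨⟨a, -, ha⟩, ⟨b, -, hb⟩⟩ := hs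
  exact h ⟨⟨a, ha⟩, ⟨b, hb⟩⟩

/-! ### Calculus of pair frequencies: sums, transport and shifts. -/

section Frequencies

variable {X Y : Type*} [DecidableEq X] [DecidableEq Y]

theorem blockFreq_zero (e : Finset Y) : blockFreq 0 e = 0 := Multiset.countP_zero _

theorem blockFreq_add (C D : Multiset (Finset Y)) (e : Finset Y) :
    blockFreq (C + D) e = blockFreq C e + blockFreq D e := Multiset.countP_add _ _ _

theorem blockFreq_nsmul (n : ℕ) (D : Multiset (Finset Y)) (e : Finset Y) :
    blockFreq (n • D) e = n * blockFreq D e := Multiset.countP_nsmul _ _ _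

theorem blockFreq_pos {D : Multiset (Finset Y)} {e : Finset Y} :
    0 < blockFreq D e ↔ ∃ b ∈ D, e ⊆ b := Multiset.countP_pos

theorem blockFreq_eq_zero {D : Multiset (Finset Y)} {e : Finset Y} :
    blockFreq D e = 0 ↔ ∀ b ∈ D, ¬ e ⊆ b := Multiset.countP_eq_zero

theorem blockFreq_map_embedding (f : X ↪ Y) (D : Multiset (Finset X)) (e : Finset X) :
    blockFreq (D.map (Finset.map f)) (e.map f) = blockFreq D e := by
  unfold blockFreq
  rw [Multiset.countP_map, Multiset.countP_eq_card_filter]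
  simp only [Finset.map_subset_map]

theorem blockFreq_map_pair (f : X ↪ Y) (D : Multiset (Finset X)) (x y : X) :
    blockFreq (D.map (Finset.map f)) {f x, f y} = blockFreq D {x, y} := by
  rw [← blockFreq_map_embedding f D {x, y}]
  simp [Finset.map_insert]

/-- The weight `w` on pairs of points is the sum of the indicator functions of a multiset of
triples. -/
def IsTripleSum (w : Y → Y → ℕ) : Prop :=
  ∃ D : Multiset (Finset Y), (∀ b ∈ D, b.card = 3) ∧
    ∀ x y, x ≠ y → blockFreq D {x, y} = w x y

namespace IsTripleSum

theorem congr {v w : Y → Y → ℕ} (hv : IsTripleSum v) (h : ∀ x y, x ≠ y → v x y = w x y) :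
    IsTripleSum w := by
  obtain ⟨D, hD, hf⟩ := hv
  exact ⟨D, hD, fun x y hxy => (hf x y hxy).trans (h x y hxy)⟩

theorem zero : IsTripleSum fun _ _ : Y => 0 :=
  ⟨0, by simp, fun _ _ _ => blockFreq_zero _⟩

theorem add {v w : Y → Y → ℕ} (hv : IsTripleSum v) (hw : IsTripleSum w) :
    IsTripleSum fun x y => v x y + w x y := by
  obtain ⟨C, hC, hCf⟩ := hv
  obtain ⟨D, hD, hDf⟩ := hw
  refine ⟨C + D, fun b hb => (Multiset.mem_add.1 hb).elim (hC b) (hD b), fun x y hxy => ?_⟩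
  rw [blockFreq_add, hCf x y hxy, hDf x y hxy]

theorem sum {ι : Type*} (s : Finset ι) {w : ι → Y → Y → ℕ} (h : ∀ i ∈ s, IsTripleSum (w i)) :
    IsTripleSum fun x y => ∑ i ∈ s, w i x y := by
  classical
  induction s using Finset.induction_on with
  | empty => simpa using zero
  | insert a s ha ih =>
    refine ((h a (mem_insert_self a s)).add
      (ih fun i hi => h i (mem_insert_of_mem hi))).congr fun x y _ => ?_
    rw [sum_insert ha]

theorem mul (n : ℕ) {w : Y → Y → ℕ} (hw : IsTripleSum w) :
    IsTripleSum fun x y => n * w x y := by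
  refine (sum (Finset.range n) (w := fun _ => w) fun _ _ => hw).congr fun x y _ => ?_
  simp

theorem map (f : X ↪ Y) {v : X → X → ℕ} {w : Y → Y → ℕ} (hv : IsTripleSum v)
    (h : ∀ x y, x ≠ y → w (f x) (f y) = v x y)
    (h0 : ∀ x y, x ≠ y → ¬ ((∃ a, f a = x) ∧ ∃ b, f b = y) → w x y = 0) :
    IsTripleSum w := by
  obtain ⟨D, hD, hf⟩ := hv
  refine ⟨D.map (Finset.map f), ?_, fun x y hxy => ?_⟩
  · intro b hb
    obtain ⟨c, hc, rfl⟩ := Multiset.mem_map.1 hb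
    rw [card_map, hD c hc]
  · by_cases hxy' : (∃ a, f a = x) ∧ ∃ b, f b = y
    · obtain ⟨⟨a, rfl⟩, ⟨b, rfl⟩⟩ := hxy'
      have hab : a ≠ b := fun h => hxy (by rw [h])
      rw [blockFreq_map_pair, hf a b hab, h a b hab]
    · rw [blockFreq_map_pair_eq_zero f D x y hxy', h0 x y hxy hxy']

end IsTripleSum

/-- The set of pairs of distinct points related by `r`. -/
def pairSet (r : Y → Y → Prop) : Set (Finset Y) := {e | ∃ x y, x ≠ y ∧ r x y ∧ e = {x, y}}

theorem pairSet_congr {r s : Y → Y → Prop} (h : ∀ x y, x ≠ y → (r x y ↔ s x y)) :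
    pairSet r = pairSet s := by
  ext e
  constructor
  · rintro ⟨x, y, hxy, hr, rfl⟩
    exact ⟨x, y, hxy, (h x y hxy).1 hr, rfl⟩
  · rintro ⟨x, y, hxy, hr, rfl⟩
    exact ⟨x, y, hxy, (h x y hxy).2 hr, rfl⟩

theorem card_of_mem_pairSet {r : Y → Y → Prop} {e : Finset Y} (h : e ∈ pairSet r) :
    e.card = 2 := by
  obtain ⟨x, y, hxy, -, rfl⟩ := h
  exact card_pair hxy

/-- Some multiset of triples covers exactly the pairs related by `r`, with pairwise distinct
frequencies that exhaust `F`. -/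
def Realizes (r : Y → Y → Prop) (F : Set ℕ) : Prop :=
  ∃ D : Multiset (Finset Y), (∀ b ∈ D, b.card = 3) ∧
    (∀ x y, x ≠ y → ¬ r x y → blockFreq D {x, y} = 0) ∧
    Set.BijOn (blockFreq D) (pairSet r) F

namespace Realizes

theorem congr {r s : Y → Y → Prop} {F : Set ℕ} (hr : Realizes r F)
    (h : ∀ x y, x ≠ y → (r x y ↔ s x y)) : Realizes s F := by
  obtain ⟨D, h3, h0, hb⟩ := hr
  exact ⟨D, h3, fun x y hxy hs => h0 x y hxy fun hr => hs ((h x y hxy).1 hr),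
    pairSet_congr h ▸ hb⟩

theorem empty {r : Y → Y → Prop} (h : ∀ x y, x ≠ y → ¬ r x y) : Realizes r ∅ := by
  refine ⟨0, by simp, fun _ _ _ _ => blockFreq_zero _, ?_⟩
  have : pairSet r = ∅ := by
    ext e
    simp only [Set.mem_empty_iff_false, iff_false]
    rintro ⟨x, y, hxy, hr, -⟩
    exact h x y hxy hr
  rw [this]
  exact Set.bijOn_empty _

theorem union {r s : Y → Y → Prop} {F G : Set ℕ} (hr : Realizes r F) (hs : Realizes s G)
    (hrs : ∀ x y, x ≠ y → r x y → ¬ s x y) (hFG : Disjoint F G) :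
    Realizes (fun x y => r x y ∨ s x y) (F ∪ G) := by
  obtain ⟨C, hC, hC0, hCb⟩ := hr
  obtain ⟨D, hD, hD0, hDb⟩ := hs
  have hCe : Set.EqOn (blockFreq C) (blockFreq (C + D)) (pairSet r) := by
    rintro e ⟨x, y, hxy, h, rfl⟩
    rw [blockFreq_add, hD0 x y hxy (hrs x y hxy h), add_zero]
  have hDe : Set.EqOn (blockFreq D) (blockFreq (C + D)) (pairSet s) := by
    rintro e ⟨x, y, hxy, h, rfl⟩
    rw [blockFreq_add, hC0 x y hxy fun h' => hrs x y hxy h' h, zero_add]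
  have hU : pairSet (fun x y => r x y ∨ s x y) = pairSet r ∪ pairSet s := by
    ext e
    constructor
    · rintro ⟨x, y, hxy, h | h, rfl⟩
      · exact Or.inl ⟨x, y, hxy, h, rfl⟩
      · exact Or.inr ⟨x, y, hxy, h, rfl⟩
    · rintro (⟨x, y, hxy, h, rfl⟩ | ⟨x, y, hxy, h, rfl⟩)
      · exact ⟨x, y, hxy, Or.inl h, rfl⟩
      · exact ⟨x, y, hxy, Or.inr h, rfl⟩
  refine ⟨C + D, fun b hb => (Multiset.mem_add.1 hb).elim (hC b) (hD b), fun x y hxy h => ?_, ?_⟩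
  · rw [not_or] at h
    rw [blockFreq_add, hC0 x y hxy h.1, hD0 x y hxy h.2]
  · rw [hU]
    have h1 := hCb.congr hCe
    have h2 := hDb.congr hDe
    refine h1.union h2 ?_
    have hne : ∀ e ∈ pairSet r, ∀ e' ∈ pairSet s,
        blockFreq (C + D) e ≠ blockFreq (C + D) e' := fun e he e' he' h =>
      Set.disjoint_left.1 hFG (h1.mapsTo he) (h ▸ h2.mapsTo he')
    refine (Set.injOn_union (Set.disjoint_left.2 fun e he he' => hne e he e he' rfl)).2
      ⟨h1.injOn, h2.injOn, hne⟩

theorem map (f : X ↪ Y) {r : X → X → Prop} {s : Y → Y → Prop} {F : Set ℕ} (hr : Realizes r F)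
    (h : ∀ x y, x ≠ y → (s (f x) (f y) ↔ r x y))
    (h0 : ∀ x y, x ≠ y → s x y → (∃ a, f a = x) ∧ ∃ b, f b = y) :
    Realizes s F := by
  obtain ⟨D, hD, hD0, hDb⟩ := hr
  refine ⟨D.map (Finset.map f), ?_, fun x y hxy hs => ?_, ?_⟩
  · intro b hb
    obtain ⟨c, hc, rfl⟩ := Multiset.mem_map.1 hb
    rw [card_map, hD c hc]
  · by_cases hxy' : (∃ a, f a = x) ∧ ∃ b, f b = y
    · obtain ⟨⟨a, rfl⟩, ⟨b, rfl⟩⟩ := hxy'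
      have hab : a ≠ b := fun h => hxy (by rw [h])
      rw [blockFreq_map_pair, hD0 a b hab fun hr => hs ((h a b hab).2 hr)]
    · rw [blockFreq_map_pair_eq_zero f D x y hxy']
  · have hS : pairSet s = Finset.map f '' pairSet r := by
      ext e
      constructor
      · rintro ⟨x, y, hxy, hs, rfl⟩
        obtain ⟨⟨a, rfl⟩, ⟨b, rfl⟩⟩ := h0 x y hxy hs
        have hab : a ≠ b := fun h => hxy (by rw [h])
        exact ⟨{a, b}, ⟨a, b, hab, (h a b hab).1 hs, rfl⟩, by simp [Finset.map_insert]⟩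
      · rintro ⟨_, ⟨a, b, hab, hr, rfl⟩, rfl⟩
        exact ⟨f a, f b, f.injective.ne hab, (h a b hab).2 hr, by simp [Finset.map_insert]⟩
    have hcomp : blockFreq (D.map (Finset.map f)) ∘ Finset.map f = blockFreq D :=
      funext fun e => blockFreq_map_embedding f D e
    rw [hS, ← Set.bijOn_comp_iff ((Finset.map_injective f).injOn), hcomp]
    exact hDb

/-- Adding triples of constant weight `c` on the related pairs translates all frequencies by `c`. -/
theorem shift {r : Y → Y → Prop} {a b : ℕ} (hr : Realizes r (Set.Ico a b)) {c : ℕ}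
    {w : Y → Y → ℕ} (hw : IsTripleSum w) (h1 : ∀ x y, x ≠ y → r x y → w x y = c)
    (h0 : ∀ x y, x ≠ y → ¬ r x y → w x y = 0) : Realizes r (Set.Ico (c + a) (c + b)) := by
  obtain ⟨D, hD, hD0, hDb⟩ := hr
  obtain ⟨C, hC, hCw⟩ := hw
  refine ⟨C + D, fun b hb => (Multiset.mem_add.1 hb).elim (hC b) (hD b), fun x y hxy h => ?_, ?_⟩
  · rw [blockFreq_add, hCw x y hxy, h0 x y hxy h, hD0 x y hxy h]
  · have he : Set.EqOn ((fun n => c + n) ∘ blockFreq D) (blockFreq (C + D)) (pairSet r) := by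
      rintro e ⟨x, y, hxy, h, rfl⟩
      simp only [Function.comp_apply]
      rw [blockFreq_add, hCw x y hxy, h1 x y hxy h]
    refine Set.BijOn.congr (Set.BijOn.comp ?_ hDb) he
    rw [← Set.image_const_add_Ico]
    exact (add_right_injective c).injOn.bijOn_image

end Realizes

end Frequencies

/-! ### Triple decompositions with constant weight on cross pairs, with and without a hole. -/

section Decompositions

theorem isTripleSum_of_finset {ι Y : Type*} [DecidableEq Y] (s : Finset ι) (t : ι → Finset Y)
    (ht : ∀ i ∈ s, (t i).card = 3) {w : Y → Y → ℕ}
    (h : ∀ x y, x ≠ y → (s.filter fun i => x ∈ t i ∧ y ∈ t i).card = w x y) : IsTripleSum w := by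
  refine ⟨s.val.map t, fun b hb => ?_, fun x y hxy => ?_⟩
  · obtain ⟨i, hi, rfl⟩ := Multiset.mem_map.1 hb
    exact ht i hi
  · rw [← h x y hxy, blockFreq, Multiset.countP_map]
    simp only [insert_subset_iff, singleton_subset_iff]
    rfl

variable {m : ℕ}

/-- The three points of the layers `p 0`, `p 1`, `p 2` on the groups `0`, `1`, `2`. -/
def transversal (p : Fin 3 → Fin m) : Finset (Fin 3 × Fin m) :=
  univ.map ⟨fun i => (i, p i), fun _ _ h => (Prod.mk.inj h).1⟩

theorem mem_transversal (p : Fin 3 → Fin m) (x : Fin 3 × Fin m) :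
    x ∈ transversal p ↔ p x.1 = x.2 := by
  obtain ⟨i, a⟩ := x
  simp only [transversal, mem_map, mem_univ, true_and]
  constructor
  · rintro ⟨j, h⟩
    obtain ⟨rfl, rfl⟩ := Prod.mk.inj h
    rfl
  · rintro rfl
    exact ⟨i, rfl⟩

theorem card_transversal (p : Fin 3 → Fin m) : (transversal p).card = 3 := by
  simp [transversal]

/-- Given values at two coordinates, the remaining one is determined by the sum being zero. -/
theorem existsUnique_sum_eq_zero {M : Type*} [AddCommGroup M] {i j : Fin 3} (hij : i ≠ j)
    (a b : M) : ∃! p : M × M, ![p.1, p.2, -p.1 - p.2] i = a ∧ ![p.1, p.2, -p.1 - p.2] j = b := by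
  fin_cases i <;> fin_cases j <;> first | exact absurd rfl hij | skip
  · exact ⟨(a, b), by simp, by rintro ⟨c, d⟩ ⟨h, h'⟩; simp_all⟩
  · refine ⟨(a, -a - b), by simp, ?_⟩
    rintro ⟨c, d⟩ ⟨h, h'⟩
    simp at h h'
    simp [← h, ← h']
  · exact ⟨(b, a), by simp, by rintro ⟨c, d⟩ ⟨h, h'⟩; simp_all⟩
  · refine ⟨(-a - b, a), by simp, ?_⟩
    rintro ⟨c, d⟩ ⟨h, h'⟩
    simp at h h'
    simp only [← h, ← h', Prod.mk.injEq, and_true]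
    abel
  · refine ⟨(b, -b - a), by simp, ?_⟩
    rintro ⟨c, d⟩ ⟨h, h'⟩
    simp at h h'
    simp [← h, ← h']
  · refine ⟨(-b - a, b), by simp, ?_⟩
    rintro ⟨c, d⟩ ⟨h, h'⟩
    simp at h h'
    simp only [← h, ← h', Prod.mk.injEq, and_true]
    abel

/-- The triples with layers `(a, b, -a - b)` form a cyclic Latin square and cover each cross pair
once. Omitting the triple with `a = b = 0` uncovers exactly the zero layer. -/
theorem isTripleSum_latin [NeZero m] : IsTripleSum fun x y : Fin 3 × Fin m =>
    if x.1 ≠ y.1 ∧ ¬ (x.2 = 0 ∧ y.2 = 0) then 1 else 0 := by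
  refine isTripleSum_of_finset (univ.filter fun p : Fin m × Fin m => p ≠ 0)
    (fun p => transversal ![p.1, p.2, -p.1 - p.2]) (fun _ _ => card_transversal _) ?_
  rintro ⟨i, a⟩ ⟨j, b⟩ hxy
  simp only [mem_transversal, filter_filter]
  by_cases hij : i = j
  · subst hij
    have hab : a ≠ b := fun h => hxy (by rw [h])
    simp only [ne_eq, not_true_eq_false, false_and, if_false, card_eq_zero]
    refine filter_eq_empty_iff.2 ?_
    rintro p - ⟨-, h, h'⟩
    exact hab (h ▸ h')
  · obtain ⟨p, ⟨hp, hp'⟩, hu⟩ := existsUnique_sum_eq_zero hij a b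
    have hz : p = 0 ↔ a = 0 ∧ b = 0 := by
      constructor
      · rintro rfl
        rw [← hp, ← hp']
        constructor
        · fin_cases i <;> simp
        · fin_cases j <;> simp
      · rintro ⟨rfl, rfl⟩
        refine (hu 0 ⟨?_, ?_⟩).symm
        · fin_cases i <;> simp
        · fin_cases j <;> simp
    by_cases h0 : a = 0 ∧ b = 0
    · rw [if_neg (by simp [h0]), card_eq_zero]
      refine filter_eq_empty_iff.2 ?_
      rintro q - ⟨h, h'⟩
      exact h ((hu q h').trans (hz.2 h0))
    · rw [if_pos ⟨hij, h0⟩, card_eq_one]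
      refine ⟨p, ?_⟩
      ext q
      simp only [mem_filter, mem_univ, true_and, mem_singleton]
      refine ⟨fun h => hu q h.2, ?_⟩
      rintro rfl
      exact ⟨fun h => h0 (hz.1 h), hp, hp'⟩

theorem isTripleSum_layer [NeZero m] : IsTripleSum fun x y : Fin 3 × Fin m =>
    if x.1 ≠ y.1 ∧ (x.2 = 0 ∧ y.2 = 0) then 1 else 0 := by
  refine isTripleSum_of_finset ({0} : Finset (Fin 3 → Fin m)) transversal
    (fun _ _ => card_transversal _) ?_
  rintro ⟨i, a⟩ ⟨j, b⟩ hxy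
  rw [filter_singleton]
  simp only [mem_transversal, Pi.zero_apply]
  by_cases h : a = 0 ∧ b = 0
  · obtain ⟨rfl, rfl⟩ := h
    have : i ≠ j := fun h => hxy (by rw [h])
    simp [this]
  · have : ¬ (0 = a ∧ 0 = b) := fun h' => h ⟨h'.1.symm, h'.2.symm⟩
    simp only [if_neg this, card_empty, h, and_false, if_false]

theorem isTripleSum_latin_full [NeZero m] : IsTripleSum fun x y : Fin 3 × Fin m =>
    if x.1 ≠ y.1 then 1 else 0 := by
  refine (isTripleSum_latin.add isTripleSum_layer).congr fun x y _ => ?_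
  by_cases h : x.1 = y.1 <;> by_cases h' : x.2 = 0 ∧ y.2 = 0 <;> simp [h, h']

theorem card_powersetCard_filter_pair {α : Type*} [DecidableEq α] (s : Finset α) {a b : α}
    (ha : a ∈ s) (hb : b ∈ s) (hab : a ≠ b) :
    ((powersetCard 3 s).filter fun T => a ∈ T ∧ b ∈ T).card = s.card - 2 := by
  have hs : ((s.erase a).erase b).card = s.card - 2 := by
    rw [card_erase_of_mem (mem_erase.2 ⟨hab.symm, hb⟩), card_erase_of_mem ha, Nat.sub_sub]
  rw [← hs]
  symm
  refine card_bij (fun c _ => {a, b, c}) ?_ ?_ ?_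
  · intro c hc
    simp only [mem_erase] at hc
    simp only [mem_filter, mem_powersetCard, insert_subset_iff, singleton_subset_iff, mem_insert,
      mem_singleton, true_or, or_true, and_true]
    exact ⟨⟨ha, hb, hc.2.2⟩, card_eq_three.2 ⟨a, b, c, hab, hc.2.1.symm, hc.1.symm, rfl⟩⟩
  · intro c hc d hd h
    simp only [mem_erase] at hc hd
    have : c ∈ ({a, b, d} : Finset α) := h ▸ by simp
    simpa [hc.1, hc.2.1] using this
  · intro T hT
    simp only [mem_filter, mem_powersetCard] at hT
    obtain ⟨⟨hTs, hT3⟩, haT, hbT⟩ := hT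
    have h1 : ((T.erase a).erase b).card = 1 := by
      rw [card_erase_of_mem (mem_erase.2 ⟨hab.symm, hbT⟩), card_erase_of_mem haT, hT3]
    obtain ⟨c, hc⟩ := card_eq_one.1 h1
    have hc' : c ∈ (T.erase a).erase b := hc ▸ mem_singleton_self c
    have hc'' := hc'
    simp only [mem_erase] at hc'
    refine ⟨c, by simp [hc'.1, hc'.2.1, hTs hc'.2.2], ?_⟩
    have : T.erase a = {b, c} := by rw [← insert_erase (mem_erase.2 ⟨hab.symm, hbT⟩), hc]
    rw [← this, insert_erase haT]

/-- A weight on three groups, copied to all triples of groups among `k` groups, covers each pair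
of points in different groups `k - 2` times. -/
theorem IsTripleSum.blow_up_groups {r : Fin m → Fin m → Prop} [DecidableRel r]
    (h : IsTripleSum fun x y : Fin 3 × Fin m => if x.1 ≠ y.1 ∧ r x.2 y.2 then 1 else 0) (k : ℕ) :
    IsTripleSum fun x y : Fin k × Fin m =>
      if x.1 ≠ y.1 ∧ r x.2 y.2 then k - 2 else 0 := by
  have hT : ∀ T ∈ powersetCard 3 (univ : Finset (Fin k)),
      IsTripleSum fun x y : Fin k × Fin m =>
        if (x.1 ≠ y.1 ∧ r x.2 y.2) ∧ x.1 ∈ T ∧ y.1 ∈ T then 1 else 0 := by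
    intro T hT
    have hT3 := (mem_powersetCard.1 hT).2
    let f : Fin 3 ↪ Fin k := (T.orderEmbOfFin hT3).toEmbedding
    have hf : ∀ i, f i ∈ T := fun i => T.orderEmbOfFin_mem hT3 i
    have hf' : ∀ i ∈ T, ∃ j, f j = i := fun i hi => by
      have : i ∈ Set.range (T.orderEmbOfFin hT3) := by
        rw [Finset.range_orderEmbOfFin]; exact hi
      exact this
    refine h.map (f.prodMap (Function.Embedding.refl _)) ?_ ?_
    · rintro ⟨i, a⟩ ⟨j, b⟩ -
      simp [hf]
    · rintro ⟨i, a⟩ ⟨j, b⟩ - hne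
      refine if_neg fun hh => hne ?_
      obtain ⟨i', rfl⟩ := hf' i hh.2.1
      obtain ⟨j', rfl⟩ := hf' j hh.2.2
      exact ⟨⟨(i', a), rfl⟩, ⟨(j', b), rfl⟩⟩
  refine (IsTripleSum.sum _ hT).congr fun x y _ => ?_
  by_cases hxy : x.1 ≠ y.1 ∧ r x.2 y.2
  · rw [if_pos hxy, ← card_filter]
    simp only [hxy.1, hxy.2, ne_eq, not_false_eq_true, true_and]
    rw [card_powersetCard_filter_pair univ (mem_univ _) (mem_univ _) hxy.1]
    simp
  · simp only [hxy, false_and, if_false, sum_const_zero]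

theorem isTripleSum_cross [NeZero m] (k : ℕ) : IsTripleSum fun x y : Fin k × Fin m =>
    if x.1 ≠ y.1 then k - 2 else 0 :=
  (IsTripleSum.blow_up_groups (r := fun _ _ : Fin m => True)
    (isTripleSum_latin_full.congr (by simp)) k).congr (by simp)

theorem isTripleSum_holey_three [NeZero m] : IsTripleSum fun x y : Fin 5 × Fin m =>
    if x.1 ≠ y.1 ∧ ¬ (x.2 = 0 ∧ y.2 = 0) then 3 else 0 :=
  IsTripleSum.blow_up_groups (r := fun a b : Fin m => ¬ (a = 0 ∧ b = 0)) isTripleSum_latin 5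

/-- In `ℤ/5` the number 3 is the inverse of 2, so `3 * (i + j)` is the midpoint of `i` and `j`. This
is an idempotent commutative quasigroup: the midpoint differs from distinct `i`, `j`, so every
triple meets three groups. -/
theorem isTripleSum_two_layers : IsTripleSum fun x y : Fin 5 × Fin 2 =>
    if x.1 ≠ y.1 ∧ ¬ (x.2 = 0 ∧ y.2 = 0) then 1 else 0 :=
  isTripleSum_of_finset (univ.filter fun p : Fin 5 × Fin 5 => p.1 < p.2)
    (fun p => {(p.1, 1), (p.2, 1), (3 * (p.1 + p.2), 0)}) (by decide +kernel) (by decide +kernel)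

/-- The same midpoint quasigroup, now over ordered pairs and with one layer for each argument and
one for the value. -/
theorem isTripleSum_three_layers : IsTripleSum fun x y : Fin 5 × Fin 3 =>
    if x.1 ≠ y.1 ∧ x.2 ≠ y.2 then 1 else 0 :=
  isTripleSum_of_finset (univ.filter fun p : Fin 5 × Fin 5 => p.1 ≠ p.2)
    (fun p => {(p.1, 0), (p.2, 1), (3 * (p.1 + p.2), 2)}) (by decide +kernel) (by decide +kernel)

theorem isTripleSum_layer_and_zero [NeZero m] {a : Fin m} (ha : a ≠ 0) :
    IsTripleSum fun x y : Fin 5 × Fin m =>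
      if x.1 ≠ y.1 ∧ ¬ (x.2 = 0 ∧ y.2 = 0) ∧ (x.2 = 0 ∨ x.2 = a) ∧ (y.2 = 0 ∨ y.2 = a)
      then 1 else 0 := by
  let f : Fin 2 ↪ Fin m := ⟨![0, a], by
    intro i j
    fin_cases i <;> fin_cases j <;> simp [ha, ha.symm]⟩
  have hf0 : f 0 = 0 := rfl
  have hf1 : f 1 = a := rfl
  have hf : ∀ i, f i = 0 ∨ f i = a := by
    intro i
    fin_cases i
    · exact Or.inl rfl
    · exact Or.inr rfl
  have hfz : ∀ i, f i = 0 ↔ i = 0 := fun i => by rw [← hf0, f.injective.eq_iff]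
  refine isTripleSum_two_layers.map ((Function.Embedding.refl _).prodMap f) ?_ ?_
  · rintro ⟨i, b⟩ ⟨j, c⟩ -
    have hf' : ∀ i, i = 0 ∨ f i = a := fun i => by rw [← hfz]; exact hf i
    simp [hf', hfz]
  · rintro ⟨i, b⟩ ⟨j, c⟩ - hne
    refine if_neg fun hh => hne ?_
    obtain ⟨-, -, hb, hc⟩ := hh
    have : ∀ b, (b = 0 ∨ b = a) → ∃ d, f d = b := by
      rintro b (rfl | rfl)
      exacts [⟨0, hf0⟩, ⟨1, hf1⟩]
    obtain ⟨b', rfl⟩ := this b hb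
    obtain ⟨c', rfl⟩ := this c hc
    exact ⟨⟨(i, b'), rfl⟩, ⟨(j, c'), rfl⟩⟩

theorem isTripleSum_layers_of_card_eq_three {T : Finset (Fin m)} (hT : T.card = 3) :
    IsTripleSum fun x y : Fin 5 × Fin m =>
      if (x.1 ≠ y.1 ∧ x.2 ≠ y.2) ∧ x.2 ∈ T ∧ y.2 ∈ T then 1 else 0 := by
  let f : Fin 3 ↪ Fin m := (T.orderEmbOfFin hT).toEmbedding
  have hf : ∀ i, f i ∈ T := fun i => T.orderEmbOfFin_mem hT i
  have hf' : ∀ i ∈ T, ∃ j, f j = i := fun i hi => by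
    have : i ∈ Set.range (T.orderEmbOfFin hT) := by
      rw [Finset.range_orderEmbOfFin]; exact hi
    exact this
  refine isTripleSum_three_layers.map ((Function.Embedding.refl _).prodMap f) ?_ ?_
  · rintro ⟨i, a⟩ ⟨j, b⟩ -
    simp [hf]
  · rintro ⟨i, a⟩ ⟨j, b⟩ - hne
    refine if_neg fun hh => hne ?_
    obtain ⟨a', rfl⟩ := hf' a hh.2.1
    obtain ⟨b', rfl⟩ := hf' b hh.2.2
    exact ⟨⟨(i, a'), rfl⟩, ⟨(j, b'), rfl⟩⟩

/-- Pairs that lie in one nonzero layer or touch layer 0 get weight `l` from `l` copies of the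
two-layer systems. Pairs in distinct nonzero layers get theirs from the triples of nonzero layers:
two given layers lie in `(m - 1) - 2 = m - 3` of these. For `m < 3` no such pair exists, so `l` is
free. -/
theorem isTripleSum_holey_of_card [NeZero m] {l : ℕ} (hl : 3 ≤ m → l = m - 3) :
    IsTripleSum fun x y : Fin 5 × Fin m =>
      if x.1 ≠ y.1 ∧ ¬ (x.2 = 0 ∧ y.2 = 0) then l else 0 := by
  have h1 := (IsTripleSum.sum (univ.erase (0 : Fin m)) fun a ha =>
    isTripleSum_layer_and_zero (mem_erase.1 ha).1).mul l
  have h2 := IsTripleSum.sum (powersetCard 3 (univ.erase (0 : Fin m))) fun T hT =>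
    isTripleSum_layers_of_card_eq_three (mem_powersetCard.1 hT).2
  refine (h1.add h2).congr ?_
  rintro ⟨i, a⟩ ⟨j, b⟩ -
  by_cases hij : i = j
  · simp [hij]
  by_cases ha : a = 0
  · by_cases hb : b = 0
    · simp [ha, hb]
    · have h0 : ∑ T ∈ powersetCard 3 (univ.erase (0 : Fin m)),
          (if (i ≠ j ∧ a ≠ b) ∧ a ∈ T ∧ b ∈ T then 1 else 0) = 0 := by
        refine sum_eq_zero fun T hT => if_neg fun h => ?_
        exact (mem_erase.1 ((mem_powersetCard.1 hT).1 h.2.1)).1 ha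
      simp only at h0 ⊢
      rw [h0, sum_eq_single b]
      · simp [hij, ha, hb]
      · intro c _ hc
        simp [hb, hc.symm]
      · simp [hb]
  · by_cases hab : a = b
    · subst hab
      simp only [ne_eq, not_true_eq_false, and_false, false_and, if_false, sum_const_zero]
      rw [sum_eq_single a]
      · simp [hij, ha]
      · intro c _ hc
        simp [ha, hc.symm]
      · simp [ha]
    by_cases hb : b = 0
    · have h0 : ∑ T ∈ powersetCard 3 (univ.erase (0 : Fin m)),
          (if (i ≠ j ∧ a ≠ b) ∧ a ∈ T ∧ b ∈ T then 1 else 0) = 0 := by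
        refine sum_eq_zero fun T hT => if_neg fun h => ?_
        exact (mem_erase.1 ((mem_powersetCard.1 hT).1 h.2.2)).1 hb
      simp only at h0 ⊢
      rw [h0, sum_eq_single a]
      · simp [hij, ha, hb]
      · intro c _ hc
        simp [ha, hc.symm]
      · simp [ha]
    · have hs : ∑ c ∈ univ.erase (0 : Fin m),
          (if i ≠ j ∧ ¬ (a = 0 ∧ b = 0) ∧ (a = 0 ∨ a = c) ∧ (b = 0 ∨ b = c)
            then 1 else 0) = 0 := by
        refine sum_eq_zero fun c _ => if_neg fun h => hab ?_
        rw [h.2.2.1.resolve_left ha, h.2.2.2.resolve_left hb]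
      have hm : 3 ≤ m := by
        have : ({0, a, b} : Finset (Fin m)).card = 3 :=
          card_eq_three.2 ⟨0, a, b, Ne.symm ha, Ne.symm hb, hab, rfl⟩
        have h' := card_le_univ ({0, a, b} : Finset (Fin m))
        rwa [this, Fintype.card_fin] at h'
      simp only at hs ⊢
      rw [hs, if_pos ⟨hij, fun h => ha h.1⟩]
      simp only [ne_eq, hij, hab, not_false_eq_true, true_and]
      rw [← card_filter, card_powersetCard_filter_pair _ (by simpa using ha) (by simpa using hb) hab,
        card_erase_of_mem (mem_univ _), card_univ, Fintype.card_fin, hl hm]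
      omega

/-- Holey weight 3 is always available; a second weight prime to 3 and at most `m` reaches every
residue class with at most two copies, which is where the bound `2 * m` comes from. -/
theorem isTripleSum_holey [NeZero m] (hm : ¬ 3 ∣ m) {l : ℕ} (hl : 3 ∣ l ∨ 2 * m ≤ l) :
    IsTripleSum fun x y : Fin 5 × Fin m =>
      if x.1 ≠ y.1 ∧ ¬ (x.2 = 0 ∧ y.2 = 0) then l else 0 := by
  have hm0 : 0 < m := Nat.pos_of_ne_zero (NeZero.ne m)
  obtain ⟨l₀, hl₀, hle, hmod⟩ : ∃ l₀, (3 ≤ m → l₀ = m - 3) ∧ l₀ ≤ m ∧ ¬ 3 ∣ l₀ := by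
    by_cases h : 3 ≤ m
    · exact ⟨m - 3, fun _ => rfl, by omega, by omega⟩
    -- For `m < 3` any weight is allowed; 1 is taken because it is prime to 3.
    · exact ⟨1, fun h' => absurd h' h, by omega, by omega⟩
  obtain ⟨c, q, rfl⟩ : ∃ c q, l = c * l₀ + q * 3 := by
    obtain h | h | h : 3 ∣ l ∨ (2 * m ≤ l ∧ 3 ∣ (l - l₀)) ∨ (2 * m ≤ l ∧ 3 ∣ (l - 2 * l₀)) := by
      have h1 : l % 3 = 0 ∨ l % 3 = 1 ∨ l % 3 = 2 := by omega
      have h2 : l₀ % 3 = 1 ∨ l₀ % 3 = 2 := by omega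
      rcases h1 with h1 | h1 | h1 <;> rcases h2 with h2 | h2 <;> omega
    · exact ⟨0, l / 3, by omega⟩
    · exact ⟨1, (l - l₀) / 3, by omega⟩
    · exact ⟨2, (l - 2 * l₀) / 3, by omega⟩
  refine (((isTripleSum_holey_of_card hl₀).mul c).add (isTripleSum_holey_three.mul q)).congr
    fun x y _ => ?_
  split_ifs <;> simp

end Decompositions

/-! ### Counting cross pairs in product coordinates. -/

section Counting

/-- The number of pairs of points in different groups of `Fin k × Fin m`. -/
theorem ncard_pairSet_fst_ne (k m : ℕ) :
    (pairSet fun x y : Fin k × Fin m => x.1 ≠ y.1).ncard = k.choose 2 * m ^ 2 := by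
  classical
  let S : Finset ((Fin k × Fin k) × (Fin m × Fin m)) :=
    (univ.filter fun p : Fin k × Fin k => p.1 < p.2) ×ˢ univ
  let f : (Fin k × Fin k) × (Fin m × Fin m) → Finset (Fin k × Fin m) :=
    fun p => {(p.1.1, p.2.1), (p.1.2, p.2.2)}
  have himg : (pairSet fun x y : Fin k × Fin m => x.1 ≠ y.1) = f '' S := by
    ext e
    constructor
    · rintro ⟨⟨i, a⟩, ⟨j, b⟩, -, hij, rfl⟩
      rcases lt_or_gt_of_ne hij with h | h
      · exact ⟨((i, j), (a, b)), by simpa [S] using h, rfl⟩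
      · exact ⟨((j, i), (b, a)), by simpa [S] using h, pair_comm _ _⟩
    · rintro ⟨⟨⟨i, j⟩, ⟨a, b⟩⟩, h, rfl⟩
      have h : i < j := by simpa [S] using h
      exact ⟨(i, a), (j, b), fun h' => h.ne (Prod.mk.inj h').1, h.ne, rfl⟩
  have hinj : Set.InjOn f S := by
    rintro ⟨⟨i, j⟩, ⟨a, b⟩⟩ h ⟨⟨i', j'⟩, ⟨a', b'⟩⟩ h' he
    replace h : i < j := by simpa [S] using h
    replace h' : i' < j' := by simpa [S] using h'
    have h1 : (i, a) ∈ f ((i', j'), (a', b')) := he ▸ by simp [f]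
    have h2 : (j, b) ∈ f ((i', j'), (a', b')) := he ▸ by simp [f]
    simp only [f, mem_insert, mem_singleton, Prod.mk.injEq] at h1 h2 ⊢
    rcases h1 with ⟨rfl, rfl⟩ | ⟨rfl, rfl⟩ <;> rcases h2 with ⟨rfl, rfl⟩ | ⟨rfl, rfl⟩
    · exact absurd h (lt_irrefl _)
    · simp
    · exact absurd (h.trans h') (lt_irrefl _)
    · exact absurd h (lt_irrefl _)
  have hlt : (univ.filter fun p : Fin k × Fin k => p.1 < p.2).card = k.choose 2 := by
    rw [card_filter, Fintype.sum_prod_type_right]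
    have hI : ∀ j : Fin k, (∑ i : Fin k, if i < j then 1 else 0) = (j : ℕ) := fun j => by
      rw [← card_filter, ← Fin.card_Iio j]
      congr 1
      ext
      simp
    simp only [hI]
    rw [Nat.choose_two_right, ← Finset.sum_range_id, Fin.sum_univ_eq_sum_range fun i => i]
  rw [himg, hinj.ncard_image, Set.ncard_coe_finset, card_product, hlt]
  simp [sq]

end Counting

/-! ### Coordinates on uniform partitions, and ingredients in these coordinates. -/

section Partitions

variable {X : Type*} [Fintype X] [DecidableEq X]

/-- Two points lie in different groups. -/
def Separated (Q : Finpartition (univ : Finset X)) (x y : X) : Prop :=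
  ∀ G ∈ Q.parts, ¬ (x ∈ G ∧ y ∈ G)

theorem coe_crossPairs (Q : Finpartition (univ : Finset X)) :
    (crossPairs Q : Set (Finset X)) = pairSet (Separated Q) := by
  ext e
  simp only [crossPairs, coe_filter, mem_powersetCard, subset_univ, true_and, Set.mem_ofPred_eq]
  constructor
  · rintro ⟨h2, h⟩
    obtain ⟨x, y, hxy, rfl⟩ := card_eq_two.1 h2
    exact ⟨x, y, hxy, fun G hG hx => h G hG (by simpa [insert_subset_iff] using hx), rfl⟩
  · rintro ⟨x, y, hxy, h, rfl⟩
    exact ⟨card_pair hxy, fun G hG hx => h G hG (by simpa [insert_subset_iff] using hx)⟩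

theorem sameGroupFreqZero_iff {Q : Finpartition (univ : Finset X)} {C : Multiset (Finset X)} :
    SameGroupFreqZero Q C ↔ ∀ x y, x ≠ y → ¬ Separated Q x y → blockFreq C {x, y} = 0 := by
  constructor
  · intro h x y hxy hs
    simp only [Separated, not_forall, not_not] at hs
    obtain ⟨G, hG, hx, hy⟩ := hs
    exact h G hG _ (mem_powersetCard.2 ⟨by simp [insert_subset_iff, hx, hy], card_pair hxy⟩)
  · intro h G hG e he
    obtain ⟨heG, h2⟩ := mem_powersetCard.1 he
    obtain ⟨x, y, hxy, rfl⟩ := card_eq_two.1 h2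
    exact h x y hxy fun hs => hs G hG (by simpa [insert_subset_iff] using heG)

/-- The length `n` can be left open: bijectivity forces it to be the number of cross pairs, so the
final assembly needs no total count. -/
theorem realizes_separated_iff {Q : Finpartition (univ : Finset X)} :
    (∃ C, IsSBGDD 0 Q C) ↔ ∃ n, Realizes (Separated Q) (Set.Ico 0 n) := by
  constructor
  · rintro ⟨C, h⟩
    exact ⟨0 + (crossPairs Q).card, C, h.block_card, sameGroupFreqZero_iff.1 h.same_group,
      coe_crossPairs Q ▸ h.cross⟩
  · rintro ⟨n, C, h3, h0, hb⟩
    refine ⟨C, h3, sameGroupFreqZero_iff.2 h0, ?_⟩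
    rw [← coe_crossPairs] at hb
    have : n = (crossPairs Q).card := by
      have := hb.image_eq ▸ hb.injOn.ncard_image
      rw [Set.ncard_coe_finset, ← Finset.coe_Ico, Set.ncard_coe_finset, Nat.card_Ico] at this
      simpa using this
    rw [← this, zero_add]
    exact hb

/-- A uniform partition is a product, with a partial transversal placed in the zero layer. -/
theorem HasUniformType.exists_equiv {Q : Finpartition (univ : Finset X)} {m k : ℕ} [NeZero m]
    (h : HasUniformType Q m k) (W : Finset X) (hW : ∀ G ∈ Q.parts, (W ∩ G).card ≤ 1) :
    ∃ e : X ≃ Fin k × Fin m, (∀ x y, (e x).1 ≠ (e y).1 ↔ Separated Q x y) ∧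
      ∀ x ∈ W, (e x).2 = 0 := by
  have ht : ∀ G : Q.parts, ∃ t : X → Fin m, Set.InjOn t G.1 ∧ ∀ x ∈ W ∩ G.1, t x = 0 := by
    rintro ⟨G, hG⟩
    let E := G.equivFinOfCardEq (h.2 G hG)
    by_cases hne : (W ∩ G).Nonempty
    · obtain ⟨w, hw⟩ := hne
      have hwG := (mem_inter.1 hw).2
      -- The swap moves the label of the one point of `W` in `G` to 0.
      refine ⟨fun x => if hx : x ∈ G then Equiv.swap (E ⟨w, hwG⟩) 0 (E ⟨x, hx⟩) else 0, ?_, ?_⟩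
      · intro x hx y hy hxy
        have hx : x ∈ G := hx
        have hy : y ∈ G := hy
        simpa [hx, hy] using hxy
      · intro x hx
        obtain rfl : x = w := card_le_one.1 (hW G hG) x hx w hw
        simp [hwG]
    · refine ⟨fun x => if hx : x ∈ G then E ⟨x, hx⟩ else 0, ?_, fun x hx => absurd ⟨x, hx⟩ hne⟩
      intro x hx y hy hxy
      have hx : x ∈ G := hx
      have hy : y ∈ G := hy
      simpa [hx, hy] using hxy
  choose t ht htW using ht
  let σ := Q.parts.equivFinOfCardEq h.1
  let p : X → Q.parts := fun x => ⟨Q.part x, Q.part_mem.2 (mem_univ x)⟩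
  have hp : ∀ x, x ∈ (p x).1 := fun x => Q.mem_part (mem_univ x)
  let f : X → Fin k × Fin m := fun x => (σ (p x), t (p x) x)
  have hcard : Fintype.card X = Fintype.card (Fin k × Fin m) := by
    rw [← card_univ, ← Q.sum_card_parts, sum_congr rfl h.2]
    simp [h.1]
  have hf : Function.Bijective f := by
    rw [Fintype.bijective_iff_injective_and_card]
    refine ⟨fun x y hxy => ?_, hcard⟩
    obtain ⟨h1, h2⟩ := Prod.mk.inj hxy
    have h1 := σ.injective h1
    rw [h1] at h2
    exact ht (p y) (h1 ▸ hp x) (hp y) h2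
  refine ⟨Equiv.ofBijective f hf, fun x y => ?_, fun x hx => htW _ _ (mem_inter.2 ⟨hx, hp x⟩)⟩
  change σ (p x) ≠ σ (p y) ↔ _
  rw [σ.injective.ne_iff]
  constructor
  · intro hne G hG hxy
    apply hne
    apply Subtype.ext
    change Q.part x = Q.part y
    rw [Q.part_eq_of_mem hG hxy.1, Q.part_eq_of_mem hG hxy.2]
  · intro hs hxy
    exact hs _ (p x).2 ⟨hp x, hxy ▸ hp y⟩

theorem HasUniformType.card_crossPairs {Q : Finpartition (univ : Finset X)} {m k : ℕ} [NeZero m]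
    (h : HasUniformType Q m k) : (crossPairs Q).card = k.choose 2 * m ^ 2 := by
  obtain ⟨e, he, -⟩ := h.exists_equiv ∅ (by simp)
  rw [← ncard_pairSet_fst_ne, ← Set.ncard_coe_finset, coe_crossPairs]
  have : (pairSet fun x y : Fin k × Fin m => x.1 ≠ y.1) =
      Finset.map e.toEmbedding '' pairSet (Separated Q) := by
    ext s
    constructor
    · rintro ⟨x, y, hxy, h, rfl⟩
      refine ⟨{e.symm x, e.symm y}, ⟨e.symm x, e.symm y, e.symm.injective.ne hxy, ?_, rfl⟩, ?_⟩
      · simpa [← he] using h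
      · simp [Finset.map_insert]
    · rintro ⟨_, ⟨x, y, hxy, h, rfl⟩, rfl⟩
      exact ⟨e x, e y, e.injective.ne hxy, (he x y).2 h, by simp [Finset.map_insert]⟩
  rw [this, Set.ncard_image_of_injective _ (Finset.map_injective _)]

theorem IsSBGDD.realizes {Q : Finpartition (univ : Finset X)} {C : Multiset (Finset X)} {m k : ℕ}
    [NeZero m] (h : IsSBGDD 0 Q C) (ht : HasUniformType Q m k) :
    Realizes (fun x y : Fin k × Fin m => x.1 ≠ y.1) (Set.Ico 0 (k.choose 2 * m ^ 2)) := by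
  obtain ⟨e, he, -⟩ := ht.exists_equiv ∅ (by simp)
  have hr : Realizes (Separated Q) (Set.Ico 0 (k.choose 2 * m ^ 2)) :=
    ⟨C, h.block_card, sameGroupFreqZero_iff.1 h.same_group, by
      have := h.cross
      rwa [coe_crossPairs, ht.card_crossPairs, zero_add] at this⟩
  exact hr.map e.toEmbedding (fun x y _ => he x y)
    fun x y _ _ => ⟨⟨e.symm x, by simp⟩, ⟨e.symm y, by simp⟩⟩

/-- Removing the blocks of a sub-`SBTS(5)` leaves a holey design. -/
theorem HasSubSBTS.realizes {Q : Finpartition (univ : Finset X)} {C : Multiset (Finset X)} {m : ℕ}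
    [NeZero m] (hs : HasSubSBTS 5 Q C) (h : IsSBGDD 0 Q C) (ht : HasUniformType Q m 5) :
    Realizes (fun x y : Fin 5 × Fin m => x.1 ≠ y.1 ∧ ¬ (x.2 = 0 ∧ y.2 = 0))
      (Set.Ico 10 (10 * m ^ 2)) := by
  obtain ⟨W, hW5, hWG, hSB, hout⟩ := hs
  obtain ⟨e, he, heW⟩ := ht.exists_equiv W hWG
  have heW' : ∀ x, (e x).2 = 0 ↔ x ∈ W := by
    have hsub : W.map e.toEmbedding ⊆ univ ×ˢ {0} := by
      intro y hy
      obtain ⟨x, hx, rfl⟩ := mem_map.1 hy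
      exact mem_product.2 ⟨mem_univ _, mem_singleton.2 (heW x hx)⟩
    -- Both sides have five points, so `W` is the whole zero layer.
    have heq := eq_of_subset_of_card_le hsub (by simp [hW5])
    intro x
    refine ⟨fun hx => ?_, heW x⟩
    have : e x ∈ W.map e.toEmbedding := heq ▸ mem_product.2 ⟨mem_univ _, mem_singleton.2 hx⟩
    simpa using this
  have hin : ∀ x y, ¬ (x ∈ W ∧ y ∈ W) →
      blockFreq (C.filter fun b => ¬ b ⊆ W) {x, y} = blockFreq C {x, y} := by
    intro x y hxy
    have h0 : blockFreq (C.filter fun b => b ⊆ W) {x, y} = 0 := by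
      rw [blockFreq_eq_zero]
      intro b hb hsub
      have := hsub.trans (Multiset.mem_filter.1 hb).2
      exact hxy (by simpa [insert_subset_iff] using this)
    conv_rhs => rw [← Multiset.filter_add_not (fun b => b ⊆ W) C, blockFreq_add, h0, zero_add]
  have hinW : ∀ x y, x ≠ y → x ∈ W → y ∈ W →
      blockFreq (C.filter fun b => ¬ b ⊆ W) {x, y} = 0 := by
    intro x y hxy hx hy
    rw [blockFreq_eq_zero]
    intro b hb hsub
    have hb := Multiset.mem_filter.1 hb
    have h1 := hout b hb.1 hb.2
    have h2 : ({x, y} : Finset X) ⊆ b ∩ W :=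
      subset_inter hsub (by simp [insert_subset_iff, hx, hy])
    have h3 := card_le_card h2
    rw [card_pair hxy] at h3
    omega
  have hr : Realizes (fun x y => Separated Q x y ∧ ¬ (x ∈ W ∧ y ∈ W))
      (Set.Ico 10 (10 * m ^ 2)) := by
    refine ⟨C.filter fun b => ¬ b ⊆ W, fun b hb => h.block_card b (Multiset.mem_filter.1 hb).1,
      fun x y hxy hn => ?_, ?_⟩
    · by_cases hxyW : x ∈ W ∧ y ∈ W
      · exact hinW x y hxy hxyW.1 hxyW.2
      · rw [hin x y hxyW]
        exact sameGroupFreqZero_iff.1 h.same_group x y hxy fun hs => hn ⟨hs, hxyW⟩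
    · have hC := h.cross
      rw [coe_crossPairs, ht.card_crossPairs, zero_add] at hC
      have hA := hSB.freq
      rw [hW5, zero_add] at hA
      have hAC : Set.EqOn (blockFreq (C.filter fun b => b ⊆ W)) (blockFreq C)
          (powersetCard 2 W : Set (Finset X)) := by
        intro s hs
        obtain ⟨hsW, hs2⟩ := mem_powersetCard.1 hs
        obtain ⟨x, y, hxy, rfl⟩ := card_eq_two.1 hs2
        rw [insert_subset_iff, singleton_subset_iff] at hsW
        conv_rhs => rw [← Multiset.filter_add_not (fun b => b ⊆ W) C, blockFreq_add,
          hinW x y hxy hsW.1 hsW.2, add_zero]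
      have hA := hA.congr hAC
      have hE : Set.EqOn (blockFreq C) (blockFreq (C.filter fun b => ¬ b ⊆ W))
          (pairSet fun x y => Separated Q x y ∧ ¬ (x ∈ W ∧ y ∈ W)) := by
        rintro _ ⟨x, y, hxy, h, rfl⟩
        exact (hin x y h.2).symm
      refine Set.BijOn.congr ⟨?_, ?_, ?_⟩ hE
      · rintro _ ⟨x, y, hxy, h, rfl⟩
        have hmem : ({x, y} : Finset X) ∈ pairSet (Separated Q) := ⟨x, y, hxy, h.1, rfl⟩
        have h1 := hC.mapsTo hmem
        refine ⟨?_, h1.2⟩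
        -- The frequencies below 10 are all taken by pairs inside `W`, so by injectivity no other
        -- pair has one.
        by_contra hlt
        obtain ⟨s, hs, hse⟩ := hA.surjOn ⟨Nat.zero_le _, by simpa [Nat.choose] using hlt⟩
        obtain ⟨hsW, hs2⟩ := mem_powersetCard.1 hs
        obtain ⟨a, b, hab, rfl⟩ := card_eq_two.1 hs2
        rw [insert_subset_iff, singleton_subset_iff] at hsW
        have hsep : Separated Q a b := fun G hG hG' =>
          hab (card_le_one.1 (hWG G hG) a (mem_inter.2 ⟨hsW.1, hG'.1⟩) b
            (mem_inter.2 ⟨hsW.2, hG'.2⟩))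
        have := hC.injOn ⟨a, b, hab, hsep, rfl⟩ hmem hse
        have hx : x ∈ ({a, b} : Finset X) := this ▸ by simp
        have hy : y ∈ ({a, b} : Finset X) := this ▸ by simp
        have hsub : ({a, b} : Finset X) ⊆ W := by simp [insert_subset_iff, hsW]
        exact h.2 ⟨hsub hx, hsub hy⟩
      · refine hC.injOn.mono ?_
        rintro _ ⟨x, y, hxy, h, rfl⟩
        exact ⟨x, y, hxy, h.1, rfl⟩
      · intro n hn
        obtain ⟨_, ⟨x, y, hxy, hs, rfl⟩, hn'⟩ := hC.surjOn ⟨Nat.zero_le n, by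
          simpa [Nat.choose] using hn.2⟩
        refine ⟨{x, y}, ⟨x, y, hxy, ⟨hs, fun hW => ?_⟩, rfl⟩, hn'⟩
        have h1 := hA.mapsTo (x := {x, y}) (mem_powersetCard.2
          ⟨by simp [insert_subset_iff, hW], card_pair hxy⟩)
        rw [hn'] at h1
        have h1 : n < 10 := by simpa [Nat.choose] using h1.2
        exact absurd hn.1 (by omega)
  refine hr.map e.toEmbedding (fun x y _ => ?_)
    fun x y _ _ => ⟨⟨e.symm x, by simp⟩, ⟨e.symm y, by simp⟩⟩
  simp [heW', ← he]

end Partitions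

/-! ### Triple systems on five points for filling the holes. -/

section CompleteGraphFive

/-- The triples of `Fin 5` in lexicographic order, with the given multiplicities. -/
def weightedTriples (n : List ℕ) : Multiset (Finset (Fin 5)) :=
  ((List.zipWith (fun k t => k • ({t} : Multiset (Finset (Fin 5)))) n
    [{0, 1, 2}, {0, 1, 3}, {0, 1, 4}, {0, 2, 3}, {0, 2, 4}, {0, 3, 4}, {1, 2, 3}, {1, 2, 4},
      {1, 3, 4}, {2, 3, 4}]).sum)

/-- Stretching frequencies: a label with tens digit `q` is moved up by `3 * r + 30 * s * q`. -/
def stretch (r s l : ℕ) : ℕ := 3 * r + 30 * s * (l / 10) + l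

theorem stretch_strictMono (r s : ℕ) : StrictMono (stretch r s) := by
  intro a b h
  have : 30 * s * (a / 10) ≤ 30 * s * (b / 10) :=
    Nat.mul_le_mul_left _ (Nat.div_le_div_right h.le)
  unfold stretch
  omega

theorem pairSet_ne_eq : pairSet (fun x y : Fin 5 => x ≠ y) =
    (powersetCard 2 (univ : Finset (Fin 5)) : Set (Finset (Fin 5))) := by
  ext e
  simp only [mem_coe, mem_powersetCard, subset_univ, true_and, card_eq_two]
  constructor
  · rintro ⟨x, y, hxy, -, rfl⟩
    exact ⟨x, y, hxy, rfl⟩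
  · rintro ⟨x, y, hxy, rfl⟩
    exact ⟨x, y, hxy, hxy, rfl⟩

/-- Three weights are superposed: all triples, `r` times, give `3 * r`; the system `p`, `5 * s`
times, gives `30 * s` times the tens digit; the system `n` gives the label itself. One finite check
thus serves all `r` and `s`. -/
theorem realizes_stretch (r s : ℕ) (p n : List ℕ) (L : Finset ℕ)
    (h3 : ∀ b ∈ weightedTriples p + weightedTriples n, b.card = 3)
    (hp : ∀ e ∈ powersetCard 2 (univ : Finset (Fin 5)),
      blockFreq (weightedTriples p) e = 6 * (blockFreq (weightedTriples n) e / 10))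
    (hn : (powersetCard 2 univ).image (blockFreq (weightedTriples n)) = L) (hL : L.card = 10) :
    Realizes (fun x y : Fin 5 => x ≠ y) (stretch r s '' L) := by
  refine ⟨r • (powersetCard 3 univ).val + (5 * s) • weightedTriples p + weightedTriples n, ?_,
    fun x y hxy h => absurd hxy h, ?_⟩
  · intro b hb
    rcases Multiset.mem_add.1 hb with hb | hb
    · rcases Multiset.mem_add.1 hb with hb | hb
      · exact (mem_powersetCard.1 (Multiset.mem_of_mem_nsmul hb)).2
      · exact h3 b (Multiset.mem_add.2 (Or.inl (Multiset.mem_of_mem_nsmul hb)))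
    · exact h3 b (Multiset.mem_add.2 (Or.inr hb))
  · rw [pairSet_ne_eq]
    have hb : Set.BijOn (blockFreq (weightedTriples n))
        (powersetCard 2 (univ : Finset (Fin 5)) : Set (Finset (Fin 5))) L := by
      rw [← hn, coe_image]
      refine Set.InjOn.bijOn_image (card_image_iff.1 ?_)
      rw [hn, hL, card_powersetCard]
      rfl
    refine Set.BijOn.congr (((stretch_strictMono r s).injective.injOn.bijOn_image).comp hb) ?_
    intro e he
    have hall : ∀ e ∈ powersetCard 2 (univ : Finset (Fin 5)),
        blockFreq (powersetCard 3 univ).val e = 3 := by decide +kernel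
    rw [blockFreq_add, blockFreq_add, blockFreq_nsmul, blockFreq_nsmul, hp e he, hall e he]
    simp only [Function.comp_apply, stretch]
    ring

theorem realizes_stretch_zero (r s : ℕ) :
    Realizes (fun x y : Fin 5 => x ≠ y) (stretch r s '' (range 10 : Finset ℕ)) :=
  realizes_stretch r s [] [0, 1, 0, 3, 0, 0, 0, 2, 4, 5] _ (by decide +kernel) (by decide +kernel)
    (by decide +kernel) (by decide +kernel)

/-- The frequencies of a triple system sum to a multiple of 3, but 10, ..., 19 sum to 145 and 20,
..., 29 to 245. Exchanging 12 and 20 turns the sums into 153 and 237, both divisible by 3. -/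
theorem realizes_stretch_one (r s : ℕ) : Realizes (fun x y : Fin 5 => x ≠ y)
    (stretch r s '' (insert 20 ((Ico 10 20).erase 12) : Finset ℕ)) :=
  realizes_stretch r s [1, 4, 1, 1, 4, 1, 1, 4, 1, 4] [5, 4, 6, 3, 9, 3, 4, 7, 6, 4] _
    (by decide +kernel) (by decide +kernel) (by decide +kernel) (by decide +kernel)

theorem realizes_stretch_two (r s : ℕ) : Realizes (fun x y : Fin 5 => x ≠ y)
    (stretch r s '' (insert 12 ((Ico 20 30).erase 20) : Finset ℕ)) :=
  realizes_stretch r s [5, 5, 2, 2, 5, 5, 2, 5, 5, 2] [13, 11, 4, 2, 11, 8, 6, 10, 10, 4] _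
    (by decide +kernel) (by decide +kernel) (by decide +kernel) (by decide +kernel)

end CompleteGraphFive

/-! ### Shifting ingredients, filling holes, and tiling an interval by three blocks of size 5. -/

section FillingHoles

variable {m : ℕ} [NeZero m]

theorem Realizes.shift_cross {k n μ c : ℕ}
    (h : Realizes (fun x y : Fin k × Fin m => x.1 ≠ y.1) (Set.Ico 0 n)) (hμ : μ = c * (k - 2)) :
    Realizes (fun x y : Fin k × Fin m => x.1 ≠ y.1) (Set.Ico μ (μ + n)) :=
  h.shift (c := μ) ((isTripleSum_cross k).mul c) (fun x y _ hxy => by simp [hxy, hμ])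
    fun x y _ hxy => by simp only [if_neg hxy, mul_zero]

theorem Realizes.fill_hole (hm : ¬ 3 ∣ m) {a b l : ℕ}
    (h : Realizes (fun x y : Fin 5 × Fin m => x.1 ≠ y.1 ∧ ¬ (x.2 = 0 ∧ y.2 = 0)) (Set.Ico a b))
    (hl : 3 ∣ l ∨ 2 * m ≤ l) {F : Set ℕ} (hF : Realizes (fun x y : Fin 5 => x ≠ y) F)
    (hd : Disjoint F (Set.Ico (l + a) (l + b))) :
    Realizes (fun x y : Fin 5 × Fin m => x.1 ≠ y.1) (F ∪ Set.Ico (l + a) (l + b)) := by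
  have h1 := h.shift (isTripleSum_holey hm hl) (fun x y _ hxy => by rw [if_pos hxy])
    fun x y _ hxy => by rw [if_neg hxy]
  let f : Fin 5 ↪ Fin 5 × Fin m := ⟨fun i => (i, 0), fun _ _ h => (Prod.mk.inj h).1⟩
  have h2 : Realizes (fun x y : Fin 5 × Fin m => x.1 ≠ y.1 ∧ (x.2 = 0 ∧ y.2 = 0)) F := by
    refine hF.map f (fun i j _ => and_iff_left ⟨rfl, rfl⟩) ?_
    rintro ⟨i, a⟩ ⟨j, b⟩ - ⟨-, ha, hb⟩
    have ha : a = 0 := ha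
    have hb : b = 0 := hb
    subst ha hb
    exact ⟨⟨i, rfl⟩, ⟨j, rfl⟩⟩
  refine (h2.union h1 (fun x y _ h h' => h'.2 h.2) hd).congr fun x y _ => ?_
  tauto

/-- The label `10 * q + d` with `d < 10` stretches to `3 * r + (30 * s + 10) * q + d`, so the
stretched labels are exactly the first ten places of each window of length `30 * s + 10`, and the
holey designs use the rest. -/
theorem disjoint_stretch_Ico {r s q : ℕ} {L : Finset ℕ} (hL : ∀ l ∈ L, l < 30) (hq : q < 3) :
    Disjoint (stretch r s '' L) (Set.Ico (3 * r + (30 * s + 10) * q + 10)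
      (3 * r + (30 * s + 10) * q + (30 * s + 10))) := by
  rw [Set.disjoint_left]
  rintro _ ⟨l, hl, rfl⟩ ⟨h1, h2⟩
  have hl := hL l hl
  have hd : l / 10 = 0 ∨ l / 10 = 1 ∨ l / 10 = 2 := by omega
  unfold stretch at h1 h2
  have hq : q = 0 ∨ q = 1 ∨ q = 2 := by omega
  rcases hd with hd | hd | hd <;> rw [hd] at h1 h2 <;> rcases hq with rfl | rfl | rfl <;> omega

theorem disjoint_union_stretch {r s q q' : ℕ} {L L' : Finset ℕ} (hL : ∀ l ∈ L, l < 30)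
    (hL' : ∀ l ∈ L', l < 30) (hLL : Disjoint L L') (hq : q < q') (hq' : q' < 3) :
    Disjoint (stretch r s '' L ∪ Set.Ico (3 * r + (30 * s + 10) * q + 10)
      (3 * r + (30 * s + 10) * q + (30 * s + 10)))
      (stretch r s '' L' ∪ Set.Ico (3 * r + (30 * s + 10) * q' + 10)
      (3 * r + (30 * s + 10) * q' + (30 * s + 10))) := by
  rw [Set.disjoint_union_left, Set.disjoint_union_right, Set.disjoint_union_right]
  refine ⟨⟨?_, disjoint_stretch_Ico hL hq'⟩,
    (disjoint_stretch_Ico hL' (hq.trans hq')).symm, ?_⟩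
  · rw [Set.disjoint_image_iff (stretch_strictMono r s).injective]
    exact_mod_cast hLL
  · rw [Set.disjoint_left]
    rintro n ⟨h1, h2⟩ ⟨h3, h4⟩
    have := Nat.mul_le_mul_left (30 * s + 10) (Nat.succ_le_of_lt hq)
    rw [Nat.mul_succ] at this
    omega

/-- Three blocks of size five, each with a holey ingredient, can use up an interval of frequencies
that starts at a multiple of three. -/
theorem exists_realizes_three (hm : ¬ 3 ∣ m)
    (h : Realizes (fun x y : Fin 5 × Fin m => x.1 ≠ y.1 ∧ ¬ (x.2 = 0 ∧ y.2 = 0))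
      (Set.Ico 10 (10 * m ^ 2))) (r : ℕ) :
    ∃ F₀ F₁ F₂ : Set ℕ, Realizes (fun x y : Fin 5 × Fin m => x.1 ≠ y.1) F₀ ∧
      Realizes (fun x y : Fin 5 × Fin m => x.1 ≠ y.1) F₁ ∧
      Realizes (fun x y : Fin 5 × Fin m => x.1 ≠ y.1) F₂ ∧
      Disjoint F₀ F₁ ∧ Disjoint F₀ F₂ ∧ Disjoint F₁ F₂ ∧
      F₀ ∪ F₁ ∪ F₂ = Set.Ico (3 * r) (3 * r + 30 * m ^ 2) := by
  obtain ⟨s, hs⟩ : ∃ s, m ^ 2 = 3 * s + 1 := by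
    have h2 : m % 3 = 1 ∨ m % 3 = 2 := by omega
    have : m ^ 2 % 3 = 1 := by
      rcases h2 with h2 | h2 <;> simp [Nat.pow_mod, h2]
    exact ⟨m ^ 2 / 3, by omega⟩
  have hmm : m ≤ m ^ 2 := Nat.le_self_pow two_ne_zero m
  have hb : 10 * m ^ 2 = 30 * s + 10 := by omega
  rw [hb] at h
  have hfill : ∀ q < 3, ∀ L : Finset ℕ, (∀ l ∈ L, l < 30) →
      Realizes (fun x y : Fin 5 => x ≠ y) (stretch r s '' L) →
      Realizes (fun x y : Fin 5 × Fin m => x.1 ≠ y.1)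
        (stretch r s '' L ∪ Set.Ico (3 * r + (30 * s + 10) * q + 10)
        (3 * r + (30 * s + 10) * q + (30 * s + 10))) := by
    intro q hq L hL hR
    -- The shift is `3 * r` for `q = 0`, a multiple of 3; for `q = 1, 2` it is at least `10 * m ^
    -- 2`, hence at least `2 * m`.
    refine h.fill_hole hm ?_ hR (disjoint_stretch_Ico hL hq)
    have hq : q = 0 ∨ q = 1 ∨ q = 2 := by omega
    rcases hq with rfl | rfl | rfl <;> omega
  have l0 : ∀ l ∈ (range 10 : Finset ℕ), l < 30 := by decide
  have l1 : ∀ l ∈ (insert 20 ((Ico 10 20).erase 12) : Finset ℕ), l < 30 := by decide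
  have l2 : ∀ l ∈ (insert 12 ((Ico 20 30).erase 20) : Finset ℕ), l < 30 := by decide
  refine ⟨_, _, _, hfill 0 (by norm_num) _ l0 (realizes_stretch_zero r s),
    hfill 1 (by norm_num) _ l1 (realizes_stretch_one r s),
    hfill 2 (by norm_num) _ l2 (realizes_stretch_two r s),
    disjoint_union_stretch l0 l1 (by decide) (by norm_num) (by norm_num),
    disjoint_union_stretch l0 l2 (by decide) (by norm_num) (by norm_num),
    disjoint_union_stretch l1 l2 (by decide) (by norm_num) (by norm_num), ?_⟩
  have hall : ∀ l ∈ range 30, l ∈ (range 10 : Finset ℕ) ∨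
      l ∈ (insert 20 ((Ico 10 20).erase 12) : Finset ℕ) ∨
      l ∈ (insert 12 ((Ico 20 30).erase 20) : Finset ℕ) := by decide
  have hstretch : ∀ l < 30, stretch r s l ∈ Set.Ico (3 * r) (3 * r + 30 * m ^ 2) := by
    intro l hl
    have hd : l / 10 = 0 ∨ l / 10 = 1 ∨ l / 10 = 2 := by omega
    rw [Set.mem_Ico]
    unfold stretch
    rcases hd with hd | hd | hd <;> rw [hd] <;> omega
  ext n
  constructor
  · rintro (((⟨l, hl, rfl⟩ | ⟨h1, h2⟩) | (⟨l, hl, rfl⟩ | ⟨h1, h2⟩)) | (⟨l, hl, rfl⟩ | ⟨h1, h2⟩))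
    · exact hstretch l (l0 l hl)
    · rw [Set.mem_Ico]; omega
    · exact hstretch l (l1 l hl)
    · rw [Set.mem_Ico]; omega
    · exact hstretch l (l2 l hl)
    · rw [Set.mem_Ico]; omega
  · rintro ⟨h1, h2⟩
    -- Locate `n` in window `q` at offset `t`: offsets below 10 are labels for the holes, the others
    -- belong to the holey design of window `q`.
    obtain ⟨q, t, hq, ht, hn⟩ : ∃ q t, q < 3 ∧ t < 30 * s + 10 ∧
        n = 3 * r + (30 * s + 10) * q + t := by
      refine ⟨(n - 3 * r) / (30 * s + 10), (n - 3 * r) % (30 * s + 10),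
        (Nat.div_lt_iff_lt_mul (by omega)).2 (by omega), Nat.mod_lt _ (by omega), ?_⟩
      have := Nat.div_add_mod (n - 3 * r) (30 * s + 10)
      omega
    by_cases ht10 : t < 10
    · have hφ : stretch r s (10 * q + t) = n := by
        have : (10 * q + t) / 10 = q := by omega
        rw [stretch, this, hn]
        ring
      rcases hall (10 * q + t) (mem_range.2 (by omega)) with hl | hl | hl
      · exact Or.inl (Or.inl (Or.inl ⟨_, hl, hφ⟩))
      · exact Or.inl (Or.inr (Or.inl ⟨_, hl, hφ⟩))
      · exact Or.inr (Or.inl ⟨_, hl, hφ⟩)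
    · have hq : q = 0 ∨ q = 1 ∨ q = 2 := by omega
      rcases hq with rfl | rfl | rfl
      · exact Or.inl (Or.inl (Or.inr ⟨by omega, by omega⟩))
      · exact Or.inl (Or.inr (Or.inr ⟨by omega, by omega⟩))
      · exact Or.inr (Or.inr ⟨by omega, by omega⟩)

end FillingHoles

/-! ### Assembling the designs over the blocks of the GDD. -/

theorem exists_cons_of_card_eq_succ {α : Type*} {s : Multiset α} {n : ℕ} (h : s.card = n + 1) :
    ∃ a t, s = a ::ₘ t ∧ t.card = n := by
  induction s using Multiset.induction_on with
  | empty => simp at h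
  | cons a t _ => exact ⟨a, t, rfl, by simpa using h⟩

section Assembly

variable {V N : Type*} [DecidableEq N] {m : ℕ}

/-- The two points lie over distinct points of a common block of `L`. -/
def Over (ε : V ≃ N) (L : Multiset (Finset V)) (x y : N × Fin m) : Prop :=
  x.1 ≠ y.1 ∧ ∃ b ∈ L, ε.symm x.1 ∈ b ∧ ε.symm y.1 ∈ b

theorem Realizes.over_singleton (ε : V ≃ N) {k : ℕ} {b : Finset V} (hb : b.card = k) {F : Set ℕ}
    (h : Realizes (fun x y : Fin k × Fin m => x.1 ≠ y.1) F) :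
    Realizes (Over (m := m) ε {b}) F := by
  let σ := b.equivFinOfCardEq hb
  let τ : Fin k ↪ N := ⟨fun i => ε (σ.symm i), fun i j hij =>
    σ.symm.injective (Subtype.ext (ε.injective hij))⟩
  have hτ : ∀ i, ε.symm (τ i) ∈ b := fun i => by
    change ε.symm (ε (σ.symm i)) ∈ b
    rw [Equiv.symm_apply_apply]
    exact (σ.symm i).2
  have hτ' : ∀ y, ε.symm y ∈ b → ∃ i, τ i = y := fun y hy => ⟨σ ⟨_, hy⟩, by
    change ε (σ.symm (σ _)) = y
    simp⟩
  refine h.map (τ.prodMap (Function.Embedding.refl _)) ?_ ?_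
  · rintro ⟨i, a⟩ ⟨j, c⟩ -
    simp [Over, hτ]
  · rintro ⟨i, a⟩ ⟨j, c⟩ - ⟨-, b', hb', hi, hj⟩
    obtain rfl := Multiset.mem_singleton.1 hb'
    obtain ⟨i', rfl⟩ := hτ' i hi
    obtain ⟨j', rfl⟩ := hτ' j hj
    exact ⟨⟨(i', a), rfl⟩, ⟨(j', c), rfl⟩⟩

theorem Realizes.over_zero (ε : V ≃ N) (a : ℕ) :
    Realizes (Over (m := m) ε 0) (Set.Ico a a) := by
  rw [Set.Ico_self]
  refine Realizes.empty ?_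
  rintro x y - ⟨-, b, hb, -⟩
  exact Multiset.notMem_zero b hb

variable [DecidableEq V]

/-- A pair lying over both a block of `L` and a block of `M` would project to a pair of frequency at
least 2 in `B`. -/
theorem Realizes.over_add {ε : V ≃ N} {B L M : Multiset (Finset V)}
    (hB : ∀ x y, x ≠ y → blockFreq B {x, y} ≤ 1) (hLM : L + M ≤ B) {F G : Set ℕ}
    (hL : Realizes (Over (m := m) ε L) F) (hM : Realizes (Over (m := m) ε M) G)
    (hFG : Disjoint F G) : Realizes (Over (m := m) ε (L + M)) (F ∪ G) := by
  refine (hL.union hM ?_ hFG).congr ?_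
  · rintro x y - ⟨hxy, b, hb, hx, hy⟩ ⟨-, c, hc, hx', hy'⟩
    have h1 : blockFreq (L + M) {ε.symm x.1, ε.symm y.1} ≤ _ := Multiset.countP_le_of_le _ hLM
    have h2 := h1.trans (hB _ _ (ε.symm.injective.ne hxy))
    rw [blockFreq_add] at h2
    have h3 : 0 < blockFreq L {ε.symm x.1, ε.symm y.1} :=
      blockFreq_pos.2 ⟨b, hb, by simp [insert_subset_iff, hx, hy]⟩
    have h4 : 0 < blockFreq M {ε.symm x.1, ε.symm y.1} :=
      blockFreq_pos.2 ⟨c, hc, by simp [insert_subset_iff, hx', hy']⟩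
    omega
  · intro x y _
    simp only [Over, Multiset.mem_add, or_and_right, exists_or, ← and_or_left]

theorem Realizes.over_add_Ico {ε : V ≃ N} {B L M : Multiset (Finset V)}
    (hB : ∀ x y, x ≠ y → blockFreq B {x, y} ≤ 1) (hLM : L + M ≤ B) {i j k : ℕ}
    (hL : Realizes (Over (m := m) ε L) (Set.Ico i j))
    (hM : Realizes (Over (m := m) ε M) (Set.Ico j k))
    (hij : i ≤ j) (hjk : j ≤ k) : Realizes (Over (m := m) ε (L + M)) (Set.Ico i k) := by
  rw [← Set.Ico_union_Ico_eq_Ico hij hjk]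
  refine hL.over_add hB hLM hM (Set.disjoint_left.2 fun n h h' => ?_)
  exact absurd h.2 (not_lt.2 h'.1)

/-- Each block consumes `d` frequencies, and `p ∣ d` keeps the next starting point admissible. -/
theorem Realizes.over_of_forall_dvd (ε : V ≃ N) {B : Multiset (Finset V)}
    (hB : ∀ x y, x ≠ y → blockFreq B {x, y} ≤ 1) {k p d : ℕ} (hpd : p ∣ d)
    (L : Multiset (Finset V)) (hLB : L ≤ B) (hk : ∀ b ∈ L, b.card = k)
    (h : ∀ b ∈ L, ∀ μ, p ∣ μ →
      Realizes (fun x y : Fin k × Fin m => x.1 ≠ y.1) (Set.Ico μ (μ + d))) :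
    ∀ μ, p ∣ μ → Realizes (Over (m := m) ε L) (Set.Ico μ (μ + L.card * d)) := by
  induction L using Multiset.induction_on with
  | empty =>
    intro μ _
    simpa using Realizes.over_zero (m := m) ε μ
  | cons b L ih =>
    intro μ hμ
    have h1 := (h b (Multiset.mem_cons_self b L) μ hμ).over_singleton ε
      (hk b (Multiset.mem_cons_self b L))
    have h2 := ih ((Multiset.le_cons_self L b).trans hLB)
      (fun c hc => hk c (Multiset.mem_cons_of_mem hc))
      (fun c hc => h c (Multiset.mem_cons_of_mem hc)) (μ + d) (dvd_add hμ hpd)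
    rw [← Multiset.singleton_add] at hLB ⊢
    have h3 := h1.over_add_Ico hB hLB h2 (by omega) (by omega)
    convert h3 using 2
    rw [Multiset.card_add, Multiset.card_singleton]
    ring

/-- Blocks of size five are handled three at a time, except possibly for the last one. -/
theorem Realizes.over_of_holey [NeZero m] (ε : V ≃ N) (hm : ¬ 3 ∣ m) {B : Multiset (Finset V)}
    (hB : ∀ x y, x ≠ y → blockFreq B {x, y} ≤ 1) {t : ℕ} (ht : t ≤ 1) (j : ℕ)
    (L : Multiset (Finset V)) (hLB : L ≤ B) (hk : ∀ b ∈ L, b.card = 5)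
    (hj : L.card = 3 * j + t)
    (h : ∀ b ∈ L, ∀ μ, 3 ∣ μ →
      Realizes (fun x y : Fin 5 × Fin m => x.1 ≠ y.1) (Set.Ico μ (μ + 10 * m ^ 2)))
    (hh : ∀ b ∈ L, Realizes (fun x y : Fin 5 × Fin m => x.1 ≠ y.1 ∧ ¬ (x.2 = 0 ∧ y.2 = 0))
      (Set.Ico 10 (10 * m ^ 2))) :
    ∀ μ, 3 ∣ μ → Realizes (Over (m := m) ε L) (Set.Ico μ (μ + L.card * (10 * m ^ 2))) := by
  induction j generalizing L with
  | zero =>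
    intro μ hμ
    obtain h0 | h1 : L.card = 0 ∨ L.card = 1 := by omega
    · obtain rfl := Multiset.card_eq_zero.1 h0
      simpa using Realizes.over_zero (m := m) ε μ
    · obtain ⟨b, rfl⟩ := Multiset.card_eq_one.1 h1
      have hb := Multiset.mem_singleton_self b
      simpa using (h b hb μ hμ).over_singleton ε (hk b hb)
  | succ j ih =>
    intro μ hμ
    obtain ⟨a, L₁, rfl, hj⟩ :=
      exists_cons_of_card_eq_succ (s := L) (n := 3 * j + t + 2) (by omega)
    obtain ⟨b, L₂, rfl, hj⟩ :=
      exists_cons_of_card_eq_succ (s := L₁) (n := 3 * j + t + 1) (by omega)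
    obtain ⟨c, L, rfl, hj⟩ :=
      exists_cons_of_card_eq_succ (s := L₂) (n := 3 * j + t) (by omega)
    have hLB' : {a} + {b} + {c} + L ≤ B := by
      simpa [add_assoc, Multiset.singleton_add] using hLB
    have habc : ({a} : Multiset (Finset V)) + {b} + {c} ≤ B :=
      (Multiset.le_add_right _ _).trans hLB'
    have hab : ({a} : Multiset (Finset V)) + {b} ≤ B := (Multiset.le_add_right _ _).trans habc
    obtain ⟨r, rfl⟩ := hμ
    obtain ⟨F₀, F₁, F₂, h0, h1, h2, h01, h02, h12, hF⟩ :=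
      exists_realizes_three hm (hh a (by simp)) r
    have h0 := h0.over_singleton ε (hk a (by simp))
    have h1 := h1.over_singleton ε (hk b (by simp))
    have h2 := h2.over_singleton ε (hk c (by simp))
    have h3 := (h0.over_add hB hab h1 h01).over_add hB habc h2
      (Set.disjoint_union_left.2 ⟨h02, h12⟩)
    rw [hF] at h3
    have h4 := ih L ((Multiset.le_add_left _ _).trans hLB') (fun d hd => hk d (by simp [hd]))
      (by omega) (fun d hd => h d (by simp [hd])) (fun d hd => hh d (by simp [hd]))
      (3 * r + 30 * m ^ 2) (by omega)
    have h5 := h3.over_add_Ico hB hLB' h4 (by omega) (by omega)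
    convert h5 using 2
    · simp [Multiset.singleton_add]
    · simp only [Multiset.card_cons]
      ring

end Assembly

/-! ### Double counting, residues mod 3, and inflating the groups. -/

theorem sum_blockFreq {V : Type*} [DecidableEq V] {S : Finset (Finset V)} (hS : ∀ e ∈ S, e.card = 2)
    (L : Multiset (Finset V)) (hL : ∀ b ∈ L, powersetCard 2 b ⊆ S) :
    ∑ e ∈ S, blockFreq L e = (L.map fun b => b.card.choose 2).sum := by
  induction L using Multiset.induction_on with
  | empty => simp [blockFreq_zero]
  | cons b L ih =>
    have hb : S.filter (fun e => e ⊆ b) = powersetCard 2 b := by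
      ext e
      rw [mem_filter, mem_powersetCard]
      exact ⟨fun h => ⟨h.2, hS e h.1⟩, fun h =>
        ⟨hL b (Multiset.mem_cons_self b L) (mem_powersetCard.2 h), h.1⟩⟩
    have hc : ∀ e, blockFreq (b ::ₘ L) e = blockFreq L e + if e ⊆ b then 1 else 0 :=
      fun e => Multiset.countP_cons _ _ _
    simp only [hc, sum_add_distrib]
    rw [ih fun c hc => hL c (Multiset.mem_cons_of_mem hc), ← card_filter, hb, card_powersetCard,
      Multiset.map_cons, Multiset.sum_cons, add_comm]

section GroupDivisible

variable {V : Type*} [Fintype V] [DecidableEq V]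

theorem IsGDD.separated_iff {K : Set ℕ} {P : Finpartition (univ : Finset V)}
    {B : Multiset (Finset V)} (h : IsGDD K P B) (x y : V) :
    Separated P x y ↔ x ≠ y ∧ ∃ b ∈ B, x ∈ b ∧ y ∈ b := by
  constructor
  · intro hs
    have hxy : x ≠ y := by
      rintro rfl
      exact hs _ (P.part_mem.2 (mem_univ x)) ⟨P.mem_part (mem_univ x), P.mem_part (mem_univ x)⟩
    have hmem : ({x, y} : Finset V) ∈ (crossPairs P : Set (Finset V)) := by
      rw [coe_crossPairs]
      exact ⟨x, y, hxy, hs, rfl⟩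
    have hpos : 0 < blockFreq B {x, y} := by
      rw [h.cross _ hmem]
      exact one_pos
    obtain ⟨b, hb, hsub⟩ := blockFreq_pos.1 hpos
    exact ⟨hxy, b, hb, by simpa [insert_subset_iff] using hsub⟩
  · rintro ⟨hxy, b, hb, hx, hy⟩
    by_contra hs
    exact blockFreq_eq_zero.1 (sameGroupFreqZero_iff.1 h.same_group x y hxy hs) b hb
      (by simp [insert_subset_iff, hx, hy])

theorem IsGDD.blockFreq_le_one {K : Set ℕ} {P : Finpartition (univ : Finset V)}
    {B : Multiset (Finset V)} (h : IsGDD K P B) (x y : V) (hxy : x ≠ y) :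
    blockFreq B {x, y} ≤ 1 := by
  by_cases hs : Separated P x y
  · refine (h.cross _ ?_).le
    rw [← mem_coe, coe_crossPairs]
    exact ⟨x, y, hxy, hs, rfl⟩
  · rw [sameGroupFreqZero_iff.1 h.same_group x y hxy hs]
    exact Nat.zero_le _

theorem IsGDD.sum_choose_two {K : Set ℕ} {P : Finpartition (univ : Finset V)}
    {B : Multiset (Finset V)} (h : IsGDD K P B) :
    (B.map fun b => b.card.choose 2).sum = (crossPairs P).card := by
  have hmem : ∀ e, e ∈ crossPairs P ↔ e ∈ pairSet (Separated P) := fun e => by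
    rw [← coe_crossPairs, mem_coe]
  rw [← sum_blockFreq (S := crossPairs P) (fun e he => card_of_mem_pairSet ((hmem e).1 he)),
    sum_congr rfl h.cross, card_eq_sum_ones]
  intro b hb e he
  obtain ⟨heb, h2⟩ := mem_powersetCard.1 he
  obtain ⟨x, y, hxy, rfl⟩ := card_eq_two.1 h2
  rw [insert_subset_iff, singleton_subset_iff] at heb
  exact (hmem _).2 ⟨x, y, hxy, (h.separated_iff x y).2 ⟨hxy, b, hb, heb⟩, rfl⟩

/-- The residue has period 3 in `u`, since `(u + 3).choose 2 = u.choose 2 + 3 * u + 3`. -/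
theorem choose_two_mod_three : ∀ u : ℕ, u.choose 2 % 3 ≠ 2
  | 0 => by decide
  | 1 => by decide
  | 2 => by decide
  | u + 3 => by
    have := choose_two_mod_three u
    have h1 : ∀ n : ℕ, (n + 1).choose 2 = n + n.choose 2 := fun n => by
      rw [Nat.choose_succ_succ' n 1, Nat.choose_one_right]
    rw [h1, h1, h1]
    omega

theorem choose_two_mul_sq_mod_three (u g : ℕ) : (u.choose 2 * g ^ 2) % 3 ≠ 2 := by
  have h1 := choose_two_mod_three u
  have h2 : g ^ 2 % 3 ≠ 2 := by
    have : g % 3 = 0 ∨ g % 3 = 1 ∨ g % 3 = 2 := by omega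
    rcases this with h | h | h <;> simp [Nat.pow_mod, h]
  have h1 : u.choose 2 % 3 = 0 ∨ u.choose 2 % 3 = 1 := by omega
  have h2 : g ^ 2 % 3 = 0 ∨ g ^ 2 % 3 = 1 := by omega
  rw [Nat.mul_mod]
  rcases h1 with h1 | h1 <;> rcases h2 with h2 | h2 <;> simp [h1, h2]

/-- Giving weight `m` to every point of a partitioned set. -/
theorem HasUniformType.exists_comap {Y : Type*} [Fintype Y] [DecidableEq Y]
    {P : Finpartition (univ : Finset V)} {g u m : ℕ} (h : HasUniformType P g u) (π : Y → V)
    (hm : 0 < m) (hπ : ∀ v, (univ.filter fun y => π y = v).card = m) :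
    ∃ R : Finpartition (univ : Finset Y), HasUniformType R (m * g) u ∧
      ∀ x y, Separated R x y ↔ Separated P (π x) (π y) := by
  have hsurj : Function.Surjective π := fun v => by
    obtain ⟨y, hy⟩ := card_pos.1 (hm.trans_eq (hπ v).symm)
    exact ⟨y, (mem_filter.1 hy).2⟩
  let φ : Finset V → Finset Y := fun G => univ.filter fun y => π y ∈ G
  have hφ : ∀ G y, y ∈ φ G ↔ π y ∈ G := by simp [φ]
  have hinj : Function.Injective φ := fun G H hGH => by
    ext v
    obtain ⟨y, rfl⟩ := hsurj v
    rw [← hφ, hGH, hφ]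
  let R : Finpartition (univ : Finset Y) := Finpartition.ofExistsUnique (P.parts.image φ)
    (fun _ _ => subset_univ _)
    (fun y _ => by
      refine ⟨φ (P.part (π y)), ⟨mem_image_of_mem _ (P.part_mem.2 (mem_univ _)),
        (hφ _ _).2 (P.mem_part (mem_univ _))⟩, ?_⟩
      rintro t ⟨ht, hy⟩
      obtain ⟨G, hG, rfl⟩ := mem_image.1 ht
      rw [P.part_eq_of_mem hG ((hφ _ _).1 hy)])
    (fun h0 => by
      obtain ⟨G, hG, hG0⟩ := mem_image.1 h0
      obtain ⟨v, hv⟩ := P.nonempty_of_mem_parts hG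
      obtain ⟨y, rfl⟩ := hsurj v
      exact notMem_empty y (hG0 ▸ (hφ G y).2 hv))
  have hR : R.parts = P.parts.image φ := rfl
  refine ⟨R, ⟨?_, ?_⟩, fun x y => ?_⟩
  · rw [hR, card_image_of_injective _ hinj, h.1]
  · intro G hG
    rw [hR] at hG
    obtain ⟨H, hH, rfl⟩ := mem_image.1 hG
    rw [card_eq_sum_card_fiberwise (f := π) (t := H) fun y hy => (hφ _ _).1 hy]
    have : ∀ v ∈ H, ((φ H).filter fun y => π y = v).card = m := fun v hv => by
      rw [← hπ v]
      congr 1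
      ext y
      simp only [mem_filter, hφ, mem_univ, true_and, and_iff_right_iff_imp]
      rintro rfl
      exact hv
    rw [sum_congr rfl this, sum_const, h.2 H hH, smul_eq_mul, mul_comm]
  · simp only [Separated, hR, forall_mem_image, hφ]

end GroupDivisible

/-! ### The main theorem. -/

theorem mainTheorem5 (g u m : ℕ) (hg : 0 < g) (hm : 0 < m)
    {V : Type*} [Fintype V] [DecidableEq V]
    (P : Finpartition (Finset.univ : Finset V)) (B : Multiset (Finset V))
    (hGDD : IsGDD {3, 4, 5} P B) (htype : HasUniformType P g u)
    (hingr : ∀ k : ℕ, (∃ b ∈ B, b.card = k) →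
      ∃ (X : Type) (_ : Fintype X) (_ : DecidableEq X)
        (Q : Finpartition (Finset.univ : Finset X)) (C : Multiset (Finset X)),
        HasUniformType Q m k ∧ IsSBGDD 0 Q C ∧ (k = 5 → ¬ 3 ∣ m → HasSubSBTS 5 Q C)) :
    ∃ (Y : Type) (_ : Fintype Y) (_ : DecidableEq Y)
      (R : Finpartition (Finset.univ : Finset Y)) (D : Multiset (Finset Y)),
      HasUniformType R (m * g) u ∧ IsSBGDD 0 R D := by
  have : NeZero m := ⟨hm.ne'⟩
  have : NeZero g := ⟨hg.ne'⟩
  have hle := hGDD.blockFreq_le_one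
  -- The new point set must live in `Type`, while `V` may lie in any universe.
  let ε : V ≃ Fin (Fintype.card V) := Fintype.equivFin V
  have hreal : ∀ k, (∃ b ∈ B, b.card = k) →
      Realizes (fun x y : Fin k × Fin m => x.1 ≠ y.1) (Set.Ico 0 (k.choose 2 * m ^ 2)) := by
    intro k hk
    obtain ⟨X, _, _, Q, C, hQ, hC, -⟩ := hingr k hk
    exact hC.realizes hQ
  have hholey : ¬ 3 ∣ m → (∃ b ∈ B, b.card = 5) →
      Realizes (fun x y : Fin 5 × Fin m => x.1 ≠ y.1 ∧ ¬ (x.2 = 0 ∧ y.2 = 0))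
        (Set.Ico 10 (10 * m ^ 2)) := by
    intro h3 hk
    obtain ⟨X, _, _, Q, C, hQ, hC, hs⟩ := hingr 5 hk
    exact (hs rfl h3).realizes hC hQ
  let L : ℕ → Multiset (Finset V) := fun k => B.filter fun b => b.card = k
  have hLB : ∀ k, L k ≤ B := fun k => Multiset.filter_le _ _
  have hLk : ∀ k, ∀ b ∈ L k, b.card = k := fun k b hb => (Multiset.mem_filter.1 hb).2
  have hLe : ∀ k, ∀ b ∈ L k, ∃ b ∈ B, b.card = k := fun k b hb => ⟨b, Multiset.mem_filter.1 hb⟩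
  have hBL : L 4 + L 5 + L 3 = B := by
    have h1 : L 4 + B.filter (fun b => ¬ b.card = 4) = B := Multiset.filter_add_not _ _
    have h2 := Multiset.filter_add_not (fun b => b.card = 5) (B.filter fun b => ¬ b.card = 4)
    rw [Multiset.filter_filter, Multiset.filter_filter] at h2
    rw [← h2, ← add_assoc] at h1
    rw [← h1]
    congr 1
    · congr 1
      exact Multiset.filter_congr fun b _ => by omega
    · refine Multiset.filter_congr fun b hb => ?_
      have := hGDD.block_card b hb
      simp only [Set.mem_insert_iff, Set.mem_singleton_iff] at this
      omega
  have h45 : L 4 + L 5 ≤ B := hBL ▸ Multiset.le_add_right _ _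
  have hc4 : (4 : ℕ).choose 2 = 6 := rfl
  have hc5 : (5 : ℕ).choose 2 = 10 := rfl
  have hc3 : (3 : ℕ).choose 2 = 3 := rfl
  have h4 : Realizes (Over (m := m) ε (L 4)) (Set.Ico 0 ((L 4).card * (6 * m ^ 2))) := by
    have := Realizes.over_of_forall_dvd (m := m) ε hle (k := 4) (p := 2) (d := 6 * m ^ 2)
      (by omega) (L 4) (hLB 4) (hLk 4) (fun b hb μ hμ => by
        obtain ⟨c, rfl⟩ := hμ
        exact hc4 ▸ (hreal 4 (hLe 4 b hb)).shift_cross (mul_comm 2 c)) 0 (by omega)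
    simpa using this
  have hshift5 : ∀ b ∈ L 5, ∀ μ, 3 ∣ μ →
      Realizes (fun x y : Fin 5 × Fin m => x.1 ≠ y.1) (Set.Ico μ (μ + 10 * m ^ 2)) := by
    rintro b hb _ ⟨c, rfl⟩
    exact hc5 ▸ (hreal 5 (hLe 5 b hb)).shift_cross (mul_comm 3 c)
  have hdvd : 3 ∣ (L 4).card * (6 * m ^ 2) := Dvd.dvd.mul_left (by omega) _
  have h5 : Realizes (Over (m := m) ε (L 5)) (Set.Ico ((L 4).card * (6 * m ^ 2))
      ((L 4).card * (6 * m ^ 2) + (L 5).card * (10 * m ^ 2))) := by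
    by_cases h3 : 3 ∣ m
    · exact Realizes.over_of_forall_dvd (m := m) ε hle
        (((h3.trans (dvd_pow_self m two_ne_zero))).mul_left 10) (L 5) (hLB 5) (hLk 5) hshift5 _ hdvd
    -- Modulo 3 the left side is the number of blocks of size 5, so at most one is left over after
    -- grouping by threes.
    · have hcard : (L 4).card * 6 + (L 5).card * 10 + (L 3).card * 3 = u.choose 2 * g ^ 2 := by
        have hs : ∀ k, ((L k).map fun b => b.card.choose 2).sum = (L k).card * k.choose 2 := by
          intro k
          rw [Multiset.map_congr rfl fun b hb => by rw [hLk k b hb], Multiset.map_const',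
            Multiset.sum_replicate, smul_eq_mul]
        rw [← htype.card_crossPairs, ← hGDD.sum_choose_two]
        conv_rhs => rw [← hBL]
        rw [Multiset.map_add, Multiset.map_add, Multiset.sum_add, Multiset.sum_add, hs, hs, hs,
          hc4, hc5, hc3]
      have hmod := choose_two_mul_sq_mod_three u g
      rw [← hcard] at hmod
      exact Realizes.over_of_holey (m := m) ε h3 hle (t := (L 5).card % 3) (by omega)
        ((L 5).card / 3) (L 5) (hLB 5) (hLk 5) (by omega) hshift5
        (fun b hb => hholey h3 (hLe 5 b hb)) _ hdvd
  have h3 := Realizes.over_of_forall_dvd (m := m) ε hle (k := 3) (p := 1) (d := 3 * m ^ 2)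
    (one_dvd _) (L 3) (hLB 3) (hLk 3) (fun b hb μ _ =>
      hc3 ▸ (hreal 3 (hLe 3 b hb)).shift_cross (mul_one μ).symm)
    ((L 4).card * (6 * m ^ 2) + (L 5).card * (10 * m ^ 2)) (one_dvd _)
  have hall := (h4.over_add_Ico hle h45 h5 (by omega) (by omega)).over_add_Ico hle hBL.le h3
    (by omega) (by omega)
  rw [hBL] at hall
  obtain ⟨R, hR, hsep⟩ := htype.exists_comap
    (fun y : Fin (Fintype.card V) × Fin m => ε.symm y.1) hm fun v => by
      have : (univ.filter fun y : Fin (Fintype.card V) × Fin m => ε.symm y.1 = v) =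
          {ε v} ×ˢ univ := by
        ext y
        rw [mem_filter_univ, mem_product, mem_singleton, Equiv.symm_apply_eq]
        exact (and_iff_left (mem_univ _)).symm
      rw [this]
      simp
  obtain ⟨D, hD⟩ := realizes_separated_iff.2 ⟨_, hall.congr (s := Separated R) fun x y _ => by
    rw [hsep, hGDD.separated_iff, ε.symm.injective.ne_iff]
    rfl⟩
  exact ⟨_, _, _, R, D, hR, hD⟩
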